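/- An Orlicz function is a convex function $M:[0,\infty)\to[0,\infty)$ with $M(0)=0$ and $M(t)>0$ for $t>0$. It is called normalized if $\int_0^\infty x\,dM'(x)=1$, where $M'$ is the right derivative of $M$. For $x\in\mathbb R^n$ put $\|x\|_M=\inf\{t>0:\sum_{i=1}^n M(|x_i|/t)\le 1\}$. **Theorem 1.1.** Let $1<q<p\le\infty$. There is a constant $c_1>0$ depending only on $p$ and $q$ and, for every constant $C$, a constant $c_2>0$ depending only on $p$, $q$ and $C$, such that the following holds. Let $M$ be a normalized Orlicz function that is $C^3$ on $(0,\infty)$, with $M'(0)=0$, and that is affine on $[T,\infty)$ for some $T>0$ (for example $T=M^{-1}(1)$). Assume that $$\lim_{t\to0^+}\frac{M''(t)}{t^{q-2}}\ \text{ exists in } [-\infty,\infty],$$ $$\int_0^s\frac{M(t)}{t^q}\,\frac{dt}{t}\le C\,\frac{M(s)}{s^q}\qquad\text{for } 0<s\le M^{-1}(1),$$ $$f(s):=\Big(1-\frac2p\Big)s^{-3}M''(s^{-1})-\frac1p\,s^{-4}M'''(s^{-1})\ge 0\qquad\text{for all } s>0,$$ where $1/\infty=0$. Then $f$, extended by $0$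 to $(-\infty,0]$, is a probability density, and for all $n$ and all $(a_{ij})_{i,j=1}^n\in\mathbb R^{n\times n}$ the random variable $\|(a_{ij}\xi_iX_j)_{i,j=1}^n\|_p$ is integrable and $$c_1\,\big\|\big(\|(a_{ij})_{j=1}^n\|_M\big)_{i=1}^n\big\|_q\le \mathbb E_\xi\mathbb E_X\big\|(a_{ij}\xi_iX_j)_{i,j=1}^n\big\|_p\le c_2\,\big\|\big(\|(a_{ij})_{j=1}^n\|_M\big)_{i=1}^n\big\|_q .$$ Here $\xi_1,\dots,\xi_n,X_1,\dots,X_n$ are independent random variables, each $\xi_i$ has the density $q(q-1)x^{-q-1}\mathbf 1_{[(q-1)^{1/q},\infty)}(x)$ and each $X_j$ has the density $f$. -/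

import Mathlib

open MeasureTheory ProbabilityTheory Filter Topology Set
open scoped ENNReal

noncomputable section

/-- An Orlicz function: a convex `M : [0,∞) → [0,∞)` with `M 0 = 0` and `M t > 0` for `t > 0`.
It is represented by a function on `ℝ` of which only the values on `[0,∞)` are used. -/
structure IsOrliczFunction (M : ℝ → ℝ) : Prop where
  convexOn : ConvexOn ℝ (Ici 0) M
  map_zero : M 0 = 0
  pos : ∀ t, 0 < t → 0 < M t

/-- `M` is normalized: `∫_0^∞ x dM'(x) = 1` as a Lebesgue-Stieltjes integral, `M'` being the right
derivative of `M`. The function `F` is determined on `[0,∞)`, hence so is its measure on `(0,∞)`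
(a possible atom at `0` would not contribute to the integral). -/
def IsNormalizedOrlicz (M : ℝ → ℝ) : Prop :=
  ∃ F : StieltjesFunction ℝ, (∀ x, 0 ≤ x → F x = derivWithin M (Ioi x) x) ∧
    ∫⁻ x in Ioi 0, ENNReal.ofReal x ∂F.measure = 1

/-- The Luxemburg norm `‖x‖_M` on `ℝⁿ`. -/
def luxemburgNorm (M : ℝ → ℝ) {ι : Type*} [Fintype ι] (x : ι → ℝ) : ℝ :=
  sInf {t : ℝ | 0 < t ∧ ∑ i, M (|x i| / t) ≤ 1}

/-- The `ℓ_p` norm of a finite family of reals, `1 ≤ p ≤ ∞`. -/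
def ellNorm (p : ℝ≥0∞) {ι : Type*} [Fintype ι] (x : ι → ℝ) : ℝ :=
  ‖(WithLp.toLp p x : PiLp p fun _ : ι => ℝ)‖

/-- `f(s) = (1 - 2/p) s⁻³ M''(1/s) - (1/p) s⁻⁴ M'''(1/s)` for `s > 0`, extended by `0`;
here `1/∞ = 0`. -/
def orliczDensity (p : ℝ≥0∞) (M : ℝ → ℝ) (s : ℝ) : ℝ :=
  if 0 < s then
    (1 - 2 * (p⁻¹).toReal) * (s ^ 3)⁻¹ * iteratedDeriv 2 M s⁻¹
      - (p⁻¹).toReal * (s ^ 4)⁻¹ * iteratedDeriv 3 M s⁻¹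
  else 0

/-- The density `q (q - 1) x^(-q-1)` on `[(q-1)^(1/q), ∞)`, and `0` elsewhere. -/
def paretoDensity (q : ℝ) (x : ℝ) : ℝ :=
  if (q - 1) ^ (1 / q) ≤ x then q * (q - 1) * x ^ (-q - 1) else 0

/-- `f` is a probability density on `ℝ`. -/
structure IsProbabilityDensity (f : ℝ → ℝ) : Prop where
  measurable : Measurable f
  nonneg : ∀ x, 0 ≤ f x
  lintegral_eq_one : ∫⁻ x, ENNReal.ofReal (f x) = 1

/-- The measure on `ℝ` with density `f`. -/
def lawOfDensity (f : ℝ → ℝ) : Measure ℝ :=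
  volume.withDensity fun x => ENNReal.ofReal (f x)

end

/-! Everything runs through the truncated mean `truncMean p ν b`, the expectation of min(1, |bx|^p)
(of 1_{|bx|>1} when p = ∞). For independent coordinates with law ν the truncated ℓ_p norm behaves
like the indicator of a union of independent events. With m(t) = ∑ truncMean(b_i/t), its mean at
scale t lies between 1 - exp(-m(t)) and m(t). Integrating over t turns these bounds into bounds for
moments of ‖(b_i x_i)‖_p.

The density f is built so that its truncated mean at b is exactly H(|b|), where H(t) = t M'(t) -
M(t) is `momentFun M` (`truncMean_eq`). Since ∫_1^∞ H(b/t) dt = M(b), the condition ∑ M(|b_i|) ≥ 1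
forces the first moment of ‖(b_i X_i)‖_p to be bounded below. Since H(t) ≤ M(2t), the growth
condition bounds the q-th moment when ∑ M(2|b_i|) ≤ 1. By homogeneity both moments are then
comparable with ‖b‖_M, in the direction needed.

For the Pareto law the truncated mean is of order |b|^q, because q < p, so the same machinery gives
E‖(b_i ξ_i)‖_p ≈ ‖b‖_q.

To combine the two, freeze X. The matrix norm is the ℓ_p norm of (ξ_i Y_i) with Y_i = ‖(a_ij
X_j)_j‖_p, so averaging over ξ leaves E_X ‖(Y_i)‖_q up to constants. From below this is at least ‖(E
Y_i)‖_q, the norm of the mean. From above it is at most (∑ E Y_i^q)^(1/q) by Jensen. This is why a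
first moment suffices for the lower bound while the upper bound needs the q-th moment. -/

noncomputable section

/-! ### Finite ℓ_p norms -/

section EllNorm

variable {ι κ : Type*} [Fintype ι] [Fintype κ]

theorem ellNorm_top (x : ι → ℝ) : ellNorm ∞ x = ⨆ i, |x i| := by
  simp [ellNorm, PiLp.norm_eq_ciSup]

theorem ellNorm_of_ne_top {p : ℝ≥0∞} (hp : 1 ≤ p) (hp' : p ≠ ∞) (x : ι → ℝ) :
    ellNorm p x = (∑ i, |x i| ^ p.toReal) ^ (1 / p.toReal) := by
  have h : 0 < p.toReal := ENNReal.toReal_pos (by positivity) hp'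
  simp [ellNorm, PiLp.norm_eq_sum h]

theorem ellNorm_ofReal {q : ℝ} (hq : 1 ≤ q) (x : ι → ℝ) :
    ellNorm (ENNReal.ofReal q) x = (∑ i, |x i| ^ q) ^ (1 / q) := by
  rw [ellNorm_of_ne_top (by simpa using hq) (by simp), ENNReal.toReal_ofReal (by linarith)]

theorem ellNorm_nonneg {p : ℝ≥0∞} (hp : 1 ≤ p) (x : ι → ℝ) : 0 ≤ ellNorm p x := by
  have : Fact (1 ≤ p) := ⟨hp⟩
  exact norm_nonneg _

theorem ellNorm_rpow {p : ℝ≥0∞} (hp : 1 ≤ p) (hp' : p ≠ ∞) (x : ι → ℝ) :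
    ellNorm p x ^ p.toReal = ∑ i, |x i| ^ p.toReal := by
  have h : 0 < p.toReal := ENNReal.toReal_pos (by positivity) hp'
  rw [ellNorm_of_ne_top hp hp', ← Real.rpow_mul (by positivity), one_div_mul_cancel h.ne',
    Real.rpow_one]

theorem ellNorm_const_mul {p : ℝ≥0∞} (hp : 1 ≤ p) {c : ℝ} (hc : 0 ≤ c) (x : ι → ℝ) :
    ellNorm p (fun i => c * x i) = c * ellNorm p x := by
  have : Fact (1 ≤ p) := ⟨hp⟩
  have : (WithLp.toLp p (fun i => c * x i) : PiLp p fun _ : ι => ℝ) = c • WithLp.toLp p x := by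
    ext i; simp
  rw [ellNorm, this, norm_smul, Real.norm_of_nonneg hc, ellNorm]

theorem continuous_ellNorm {p : ℝ≥0∞} (hp : 1 ≤ p) :
    Continuous (ellNorm p : (ι → ℝ) → ℝ) := by
  have : Fact (1 ≤ p) := ⟨hp⟩
  exact continuous_norm.comp (PiLp.continuous_toLp p _)

theorem ellNorm_ofReal_mono {q : ℝ} (hq : 1 ≤ q) {x y : ι → ℝ} (h : ∀ i, |x i| ≤ |y i|) :
    ellNorm (ENNReal.ofReal q) x ≤ ellNorm (ENNReal.ofReal q) y := by
  rw [ellNorm_ofReal hq, ellNorm_ofReal hq]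
  exact Real.rpow_le_rpow (Finset.sum_nonneg fun i _ => by positivity)
    (Finset.sum_le_sum fun i _ => Real.rpow_le_rpow (abs_nonneg _) (h i) (by linarith))
    (by positivity)

/-- An ℓ_p norm over a product index set is an iterated ℓ_p norm. This isolates the row factors ξ_i
from the column variables X_j. -/
theorem ellNorm_prod {p : ℝ≥0∞} (hp : 1 ≤ p) (b : ι → ℝ) (y : ι → κ → ℝ) :
    ellNorm p (fun ij : ι × κ => b ij.1 * y ij.1 ij.2)
      = ellNorm p (fun i => b i * ellNorm p (y i)) := by
  rcases eq_or_ne p ∞ with rfl | hp'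
  · rw [ellNorm_top, ellNorm_top]
    apply le_antisymm
    · refine Real.iSup_le (fun ij => ?_) (Real.iSup_nonneg fun _ => abs_nonneg _)
      refine le_trans ?_ (le_ciSup (f := fun i => |b i * ellNorm ∞ (y i)|)
        (Set.finite_range _).bddAbove ij.1)
      rw [abs_mul, abs_mul]
      refine mul_le_mul_of_nonneg_left ?_ (abs_nonneg _)
      rw [ellNorm_top, abs_of_nonneg (Real.iSup_nonneg fun _ => abs_nonneg _)]
      exact le_ciSup (f := fun j => |y ij.1 j|) (Set.finite_range _).bddAbove ij.2
    · refine Real.iSup_le (fun i => ?_) (Real.iSup_nonneg fun _ => abs_nonneg _)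
      rw [abs_mul, ellNorm_top, abs_of_nonneg (Real.iSup_nonneg fun _ => abs_nonneg _),
        Real.mul_iSup_of_nonneg (abs_nonneg _)]
      refine Real.iSup_le (fun j => ?_) (Real.iSup_nonneg fun _ => abs_nonneg _)
      rw [← abs_mul]
      exact le_ciSup (f := fun ij : ι × κ => |b ij.1 * y ij.1 ij.2|)
        (Set.finite_range _).bddAbove (i, j)
  · rw [ellNorm_of_ne_top hp hp', ellNorm_of_ne_top hp hp' (fun i => b i * ellNorm p (y i))]
    congr 1
    rw [Fintype.sum_prod_type]
    refine Finset.sum_congr rfl fun i _ => ?_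
    rw [abs_mul, abs_of_nonneg (ellNorm_nonneg hp _), Real.mul_rpow (abs_nonneg _)
      (ellNorm_nonneg hp _), ellNorm_rpow hp hp', Finset.mul_sum]
    refine Finset.sum_congr rfl fun j _ => ?_
    rw [abs_mul, Real.mul_rpow (abs_nonneg _) (abs_nonneg _)]

end EllNorm

/-! ### Truncated powers as soft indicators -/

/-- The truncated power `min 1 (y ^ p)`, read as the indicator of `y > 1` for `p = ∞`. -/
def truncPow (p : ℝ≥0∞) (y : ℝ) : ℝ :=
  if p = ∞ then (if 1 < y then 1 else 0) else min 1 (y ^ p.toReal)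

theorem one_sub_sum_le_prod_one_sub {ι : Type*} (s : Finset ι) (k : ι → ℝ) (h0 : ∀ i, 0 ≤ k i)
    (h1 : ∀ i, k i ≤ 1) : 1 - ∑ i ∈ s, k i ≤ ∏ i ∈ s, (1 - k i) := by
  classical
  induction s using Finset.induction_on with
  | empty => simp
  | insert a s ha ih =>
    rw [Finset.sum_insert ha, Finset.prod_insert ha]
    nlinarith [h0 a, h1 a, Finset.sum_nonneg fun i (_ : i ∈ s) => h0 i]

section TruncPow

variable {p : ℝ≥0∞}

theorem measurable_truncPow : Measurable (truncPow p) := by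
  unfold truncPow
  split_ifs
  · exact Measurable.ite measurableSet_Ioi measurable_const measurable_const
  · exact measurable_const.min (measurable_id.pow_const _)

theorem truncPow_nonneg {y : ℝ} (hy : 0 ≤ y) : 0 ≤ truncPow p y := by
  unfold truncPow
  split_ifs <;> positivity

theorem truncPow_le_one (y : ℝ) : truncPow p y ≤ 1 := by
  unfold truncPow
  split_ifs <;> simp

theorem truncPow_of_one_lt {y : ℝ} (hy : 1 < y) : truncPow p y = 1 := by
  unfold truncPow
  split_ifs
  · rfl
  · exact min_eq_left (Real.one_le_rpow hy.le ENNReal.toReal_nonneg)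

/-- On [0, 1] a larger exponent gives a smaller power, and beyond 1 the truncation takes over.
Estimates with a finite exponent r ≤ p therefore cover p = ∞ as well. -/
theorem truncPow_le_min_rpow {r y : ℝ} (hr : 0 < r) (hrp : ENNReal.ofReal r ≤ p) (hy : 0 ≤ y) :
    truncPow p y ≤ min 1 (y ^ r) := by
  refine le_min (truncPow_le_one y) ?_
  rcases lt_or_ge 1 y with h | h
  · exact (truncPow_le_one y).trans (Real.one_le_rpow h.le hr.le)
  · unfold truncPow
    split_ifs with h1 h2
    · exact absurd h2 h.not_gt
    · positivity
    · refine (min_le_right _ _).trans ?_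
      have hr' : r ≤ p.toReal := (ENNReal.ofReal_le_iff_le_toReal h1).1 hrp
      rcases hy.eq_or_lt with rfl | hy
      · rw [Real.zero_rpow hr.ne', Real.zero_rpow (hr.trans_le hr').ne']
      · exact Real.rpow_le_rpow_of_exponent_ge hy h hr'

theorem truncPow_le_self (hp : 1 ≤ p) {y : ℝ} (hy : 0 ≤ y) : truncPow p y ≤ y := by
  have := truncPow_le_min_rpow one_pos (by simpa using hp) hy
  rw [Real.rpow_one] at this
  exact this.trans (min_le_right _ _)

variable {ι : Type*} [Fintype ι]

/-- The union bound: either no coordinate is truncated and the p-th powers add up, or a single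
truncated coordinate already contributes 1. -/
theorem truncPow_ellNorm_le_sum (hp : 1 ≤ p) (y : ι → ℝ) :
    truncPow p (ellNorm p y) ≤ ∑ i, truncPow p |y i| := by
  rcases eq_or_ne p ∞ with rfl | hp'
  · by_cases h : 1 < ellNorm ∞ y
    · rw [truncPow_of_one_lt h]
      rw [ellNorm_top] at h
      obtain ⟨i, hi⟩ : ∃ i, 1 < |y i| := by
        by_contra! hc
        exact absurd h (Real.iSup_le hc zero_le_one).not_gt
      calc (1 : ℝ) = truncPow ∞ |y i| := (truncPow_of_one_lt hi).symm
        _ ≤ _ := Finset.single_le_sum (f := fun i => truncPow ∞ |y i|)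
          (fun j _ => truncPow_nonneg (abs_nonneg _)) (Finset.mem_univ i)
    · simp only [truncPow, if_true, if_neg h]
      exact Finset.sum_nonneg fun i _ => by split_ifs <;> simp
  · simp only [truncPow, if_neg hp', ellNorm_rpow hp hp']
    by_cases h : ∀ i, |y i| ^ p.toReal ≤ 1
    · exact (min_le_right _ _).trans
        (Finset.sum_le_sum fun i _ => by rw [min_eq_right (h i)])
    · push Not at h
      obtain ⟨i, hi⟩ := h
      refine (min_le_left _ _).trans ?_
      calc (1 : ℝ) = min 1 (|y i| ^ p.toReal) := (min_eq_left hi.le).symm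
        _ ≤ _ := Finset.single_le_sum (f := fun i => min 1 (|y i| ^ p.toReal))
          (fun j _ => by positivity) (Finset.mem_univ i)

/-- The converse of the union bound, in a product form that factors under independence. For p = ∞ it
compares with the event that some coordinate exceeds 1; for finite p it follows from 1 - ∏(1 - k_i)
≤ ∑ k_i. -/
theorem one_sub_prod_le_truncPow_ellNorm (hp : 1 ≤ p) (y : ι → ℝ) :
    1 - ∏ i, (1 - truncPow p |y i|) ≤ truncPow p (ellNorm p y) := by
  have hprod : 0 ≤ ∏ i, (1 - truncPow p |y i|) :=
    Finset.prod_nonneg fun i _ => sub_nonneg.2 (truncPow_le_one _)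
  rcases eq_or_ne p ∞ with rfl | hp'
  · by_cases h : ∃ i, 1 < |y i|
    · obtain ⟨i, hi⟩ := h
      have : 1 < ellNorm ∞ y := by
        rw [ellNorm_top]
        exact hi.trans_le (le_ciSup (f := fun i => |y i|) (Set.finite_range _).bddAbove i)
      rw [truncPow_of_one_lt this]
      linarith
    · push Not at h
      have : ∀ i, truncPow ∞ |y i| = 0 := fun i => by simp [truncPow, (h i).not_gt]
      simp only [this]
      simpa using truncPow_nonneg (ellNorm_nonneg hp y)
  · have hsum := one_sub_sum_le_prod_one_sub Finset.univ (fun i => truncPow p |y i|)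
      (fun i => truncPow_nonneg (abs_nonneg _)) fun i => truncPow_le_one _
    have hle : ∑ i, truncPow p |y i| ≤ ∑ i, |y i| ^ p.toReal :=
      Finset.sum_le_sum fun i _ => by simp [truncPow, hp']
    rw [truncPow, if_neg hp', ellNorm_rpow hp hp']
    exact le_min (by linarith) (by linarith)

end TruncPow

/-! ### Integration over scales, and independent coordinates -/

theorem lintegral_Ioi_ofReal_rpow {a c : ℝ} (ha : a < -1) (hc : 0 < c) :
    ∫⁻ t in Ioi c, ENNReal.ofReal (t ^ a) = ENNReal.ofReal (-c ^ (a + 1) / (a + 1)) := by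
  rw [← integral_Ioi_rpow_of_lt ha hc, ofReal_integral_eq_lintegral_ofReal
    (integrableOn_Ioi_rpow_of_lt ha hc)]
  filter_upwards [ae_restrict_mem measurableSet_Ioi] with t ht
  exact Real.rpow_nonneg (hc.trans ht).le _

/-- Lowering the exponent to q and splitting at t = y gives y + y/(q - 1). The bound is finite
because q > 1. -/
theorem lintegral_truncPow_div_le {p : ℝ≥0∞} {q y : ℝ} (hq : 1 < q) (hqp : ENNReal.ofReal q ≤ p)
    (hy : 0 ≤ y) :
    ∫⁻ t in Ioi 0, ENNReal.ofReal (truncPow p (y / t)) ≤ ENNReal.ofReal (q / (q - 1) * y) := by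
  have hq0 : 0 < q := by linarith
  have key : ∀ t, 0 < t → truncPow p (y / t) ≤ min 1 (y ^ q * t ^ (-q)) := fun t ht => by
    refine (truncPow_le_min_rpow hq0 hqp (by positivity)).trans_eq ?_
    rw [Real.div_rpow hy ht.le, Real.rpow_neg ht.le, div_eq_mul_inv]
  rcases hy.eq_or_lt with rfl | hy
  · rw [setLIntegral_congr_fun (g := fun _ => 0) measurableSet_Ioi]
    · simp
    · intro t ht
      simpa [Real.zero_rpow hq0.ne'] using key t ht
  · rw [← Ioc_union_Ioi_eq_Ioi hy.le]
    refine (lintegral_union_le _ _ _).trans ?_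
    have h1 : ∫⁻ t in Ioc 0 y, ENNReal.ofReal (truncPow p (y / t)) ≤ ENNReal.ofReal y := by
      calc _ ≤ ∫⁻ t in Ioc 0 y, 1 := lintegral_mono fun t => by
            simpa using truncPow_le_one _
        _ = _ := by simp
    have h2 : ∫⁻ t in Ioi y, ENNReal.ofReal (truncPow p (y / t))
        ≤ ENNReal.ofReal (y / (q - 1)) := by
      calc _ ≤ ∫⁻ t in Ioi y, ENNReal.ofReal (y ^ q) * ENNReal.ofReal (t ^ (-q)) := by
            refine setLIntegral_mono' measurableSet_Ioi fun t ht => ?_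
            rw [← ENNReal.ofReal_mul (by positivity)]
            exact ENNReal.ofReal_le_ofReal ((key t (hy.trans ht)).trans (min_le_right _ _))
        _ = ENNReal.ofReal (y ^ q) * ENNReal.ofReal (-y ^ (-q + 1) / (-q + 1)) := by
            rw [lintegral_const_mul' _ _ ENNReal.ofReal_ne_top,
              lintegral_Ioi_ofReal_rpow (by linarith) hy]
        _ = _ := by
            rw [← ENNReal.ofReal_mul (by positivity)]
            congr 1
            have : y ^ q * y ^ (-q + 1) = y := by
              rw [← Real.rpow_add hy]; simp
            have h3 : q - 1 ≠ 0 := by linarith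
            have h4 : -q + 1 ≠ 0 := by intro h; apply h3; linarith
            field_simp
            rw [this]
            ring
    refine (add_le_add h1 h2).trans_eq ?_
    rw [← ENNReal.ofReal_add hy.le (by have : 0 < q - 1 := by linarith
                                       positivity)]
    congr 1
    have h3 : q - 1 ≠ 0 := by linarith
    field_simp
    ring

/-- The mean of `truncPow p |b x|` under `ν`. -/
def truncMean (p : ℝ≥0∞) (ν : Measure ℝ) (b : ℝ) : ℝ := ∫ x, truncPow p |b * x| ∂ν

theorem truncMean_nonneg {p : ℝ≥0∞} {ν : Measure ℝ} (b : ℝ) : 0 ≤ truncMean p ν b :=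
  integral_nonneg fun _ => truncPow_nonneg (abs_nonneg _)

section Product

variable {p : ℝ≥0∞} {ν : Measure ℝ} [IsProbabilityMeasure ν] {n : ℕ}

theorem integrable_truncPow_comp {α : Type*} [MeasurableSpace α] {μ : Measure α}
    [IsFiniteMeasure μ] {g : α → ℝ} (hg : Measurable g) (hg0 : ∀ x, 0 ≤ g x) :
    Integrable (fun x => truncPow p (g x)) μ :=
  Integrable.of_bound (measurable_truncPow.comp hg).aestronglyMeasurable 1
    (Eventually.of_forall fun x => by
      rw [Real.norm_of_nonneg (truncPow_nonneg (hg0 x))]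
      exact truncPow_le_one _)

theorem integrable_truncPow_abs_mul (b : ℝ) : Integrable (fun x => truncPow p |b * x|) ν :=
  integrable_truncPow_comp (measurable_const.mul measurable_id).abs fun _ => abs_nonneg _

theorem measurable_ellNorm_mul (hp : 1 ≤ p) (b : Fin n → ℝ) :
    Measurable fun x : Fin n → ℝ => ellNorm p fun i => b i * x i :=
  (continuous_ellNorm hp).measurable.comp (by fun_prop)

theorem integral_truncPow_ellNorm_le (hp : 1 ≤ p) (b : Fin n → ℝ) :
    ∫ x, truncPow p (ellNorm p fun i => b i * x i) ∂(Measure.pi fun _ : Fin n => ν)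
      ≤ ∑ i, truncMean p ν (b i) := by
  have hi : ∀ i, Integrable (fun x : Fin n → ℝ => truncPow p |b i * x i|)
      (Measure.pi fun _ : Fin n => ν) := fun i =>
    integrable_truncPow_comp (by fun_prop) fun _ => abs_nonneg _
  calc _ ≤ ∫ x, ∑ i, truncPow p |b i * x i| ∂(Measure.pi fun _ : Fin n => ν) :=
        integral_mono (integrable_truncPow_comp (measurable_ellNorm_mul hp b)
          fun _ => ellNorm_nonneg hp _) (integrable_finsetSum _ fun i _ => hi i)
          fun x => truncPow_ellNorm_le_sum hp _
    _ = _ := by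
        rw [integral_finsetSum _ fun i _ => hi i]
        refine Finset.sum_congr rfl fun i _ => ?_
        exact integral_comp_eval (μ := fun _ : Fin n => ν) (i := i)
          (integrable_truncPow_abs_mul (p := p) (ν := ν) (b i)).aestronglyMeasurable

/-- Independence factors the mean of the product in `one_sub_prod_le_truncPow_ellNorm`, and 1 - x ≤
exp(-x) is applied to each factor. -/
theorem one_sub_exp_le_integral_truncPow_ellNorm (hp : 1 ≤ p) (b : Fin n → ℝ) :
    1 - Real.exp (-∑ i, truncMean p ν (b i))
      ≤ ∫ x, truncPow p (ellNorm p fun i => b i * x i) ∂(Measure.pi fun _ : Fin n => ν) := by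
  have h1 : ∀ i, ∫ x, (1 - truncPow p |b i * x|) ∂ν = 1 - truncMean p ν (b i) := fun i => by
    rw [integral_sub (integrable_const _) (integrable_truncPow_abs_mul _)]
    simp [truncMean]
  have hb : ∀ z : ℝ, 0 ≤ 1 - truncPow p |z| := fun z => sub_nonneg.2 (truncPow_le_one _)
  have hint : Integrable (fun x : Fin n → ℝ => ∏ i, (1 - truncPow p |b i * x i|))
      (Measure.pi fun _ : Fin n => ν) := by
    refine Integrable.of_bound (Measurable.aestronglyMeasurable ?_) 1
      (Eventually.of_forall fun x => ?_)
    · exact Finset.measurable_prod _ fun i _ => measurable_const.sub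
        (measurable_truncPow.comp (by fun_prop))
    · rw [Real.norm_of_nonneg (Finset.prod_nonneg fun i _ => hb _)]
      exact Finset.prod_le_one (fun i _ => hb _)
        fun i _ => sub_le_self _ (truncPow_nonneg (abs_nonneg _))
  calc _ ≤ 1 - ∏ i, (1 - truncMean p ν (b i)) := by
        rw [← Finset.sum_neg_distrib, Real.exp_sum]
        refine sub_le_sub_left (Finset.prod_le_prod (fun i _ => ?_) fun i _ => ?_) _
        · rw [← h1]
          exact integral_nonneg fun x => hb _
        · linarith [Real.add_one_le_exp (-truncMean p ν (b i))]
    _ = ∫ x, (1 - ∏ i, (1 - truncPow p |b i * x i|)) ∂(Measure.pi fun _ : Fin n => ν) := by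
        rw [integral_sub (integrable_const _) hint,
          integral_fintype_prod_eq_prod (fun (i : Fin n) (x : ℝ) => 1 - truncPow p |b i * x|),
          Finset.prod_congr rfl fun i _ => h1 i]
        simp
    _ ≤ _ := integral_mono ((integrable_const _).sub hint)
        (integrable_truncPow_comp (measurable_ellNorm_mul hp b) fun _ => ellNorm_nonneg hp _)
        fun x => one_sub_prod_le_truncPow_ellNorm hp _

theorem ellNorm_div {ι : Type*} [Fintype ι] (hp : 1 ≤ p) {t : ℝ} (ht : 0 ≤ t) (y : ι → ℝ) :
    ellNorm p (fun i => y i / t) = ellNorm p y / t := by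
  simp only [div_eq_inv_mul]
  exact ellNorm_const_mul hp (inv_nonneg.2 ht) y

/-- The previous bound is integrated over all scales t; by Tonelli the scale integral can be done
first, pointwise in x, where it recovers the norm up to q/(q - 1). -/
theorem lintegral_one_sub_exp_le {q : ℝ} (hq : 1 < q) (hqp : ENNReal.ofReal q ≤ p)
    (b : Fin n → ℝ) :
    ∫⁻ t in Ioi (0 : ℝ), ENNReal.ofReal (1 - Real.exp (-∑ i, truncMean p ν (b i / t)))
      ≤ ENNReal.ofReal (q / (q - 1)) *
        ∫⁻ x, ENNReal.ofReal (ellNorm p fun i => b i * x i) ∂(Measure.pi fun _ : Fin n => ν) := by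
  have hp : 1 ≤ p := le_trans (by simpa using hq.le) hqp
  have hm := measurable_ellNorm_mul (p := p) hp b
  calc _ ≤ ∫⁻ t in Ioi (0 : ℝ), ∫⁻ x, ENNReal.ofReal
          (truncPow p ((ellNorm p fun i => b i * x i) / t)) ∂(Measure.pi fun _ : Fin n => ν) := by
        refine setLIntegral_mono' measurableSet_Ioi fun t ht => ?_
        have ht : 0 < t := ht
        rw [← ofReal_integral_eq_lintegral_ofReal
          (integrable_truncPow_comp (hm.div_const t)
            fun x => div_nonneg (ellNorm_nonneg hp _) ht.le)
          (Eventually.of_forall fun x => truncPow_nonneg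
            (div_nonneg (ellNorm_nonneg hp _) ht.le))]
        refine ENNReal.ofReal_le_ofReal ((one_sub_exp_le_integral_truncPow_ellNorm hp
          fun i => b i / t).trans_eq ?_)
        refine integral_congr_ae (Eventually.of_forall fun x => ?_)
        simp only [← ellNorm_div hp ht.le, div_mul_eq_mul_div]
    _ = ∫⁻ x, (∫⁻ t in Ioi (0 : ℝ), ENNReal.ofReal
          (truncPow p ((ellNorm p fun i => b i * x i) / t))) ∂(Measure.pi fun _ : Fin n => ν) := by
        rw [lintegral_lintegral_swap]
        refine Measurable.aemeasurable ?_
        exact (measurable_truncPow.comp ((hm.comp measurable_snd).div measurable_fst)).ennreal_ofReal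
    _ ≤ ∫⁻ x, ENNReal.ofReal (q / (q - 1)) * ENNReal.ofReal (ellNorm p fun i => b i * x i)
          ∂(Measure.pi fun _ : Fin n => ν) := by
        refine lintegral_mono fun x => ?_
        rw [← ENNReal.ofReal_mul (div_nonneg (by linarith) (by linarith))]
        exact lintegral_truncPow_div_le hq hqp (ellNorm_nonneg hp _)
    _ = _ := lintegral_const_mul' _ _ ENNReal.ofReal_ne_top

/-- Layer-cake formula for the s-th moment. Levels t ≤ 1 contribute at most 1 since probabilities
are at most 1. For t > 1 the event that the norm exceeds t is dominated by the truncated power,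
hence by the union bound. Continuity of the majorants φ only serves measurability. -/
theorem lintegral_ellNorm_rpow_le (hp : 1 ≤ p) {s : ℝ} (hs : 0 < s) (b : Fin n → ℝ)
    (φ : Fin n → ℝ → ℝ) (hφ : ∀ i, ContinuousOn (φ i) (Ioi 1))
    (hle : ∀ i t, 1 < t → truncMean p ν (b i / t) ≤ φ i t) :
    ∫⁻ x, ENNReal.ofReal ((ellNorm p fun i => b i * x i) ^ s) ∂(Measure.pi fun _ : Fin n => ν)
      ≤ 1 + ∑ i, ENNReal.ofReal s *
        ∫⁻ t in Ioi 1, ENNReal.ofReal (φ i t) * ENNReal.ofReal (t ^ (s - 1)) := by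
  set π := Measure.pi fun _ : Fin n => ν with hπ
  set g : (Fin n → ℝ) → ℝ := fun x => ellNorm p fun i => b i * x i with hg
  have hm : Measurable g := measurable_ellNorm_mul hp b
  have hg0 : ∀ x, 0 ≤ g x := fun x => ellNorm_nonneg hp _
  rw [lintegral_rpow_eq_lintegral_meas_lt_mul π (Eventually.of_forall hg0) hm.aemeasurable hs,
    ← Ioc_union_Ioi_eq_Ioi (zero_le_one (α := ℝ))]
  have h1 : ∫⁻ t in Ioc 0 1, π {x | t < g x} * ENNReal.ofReal (t ^ (s - 1))
      ≤ (ENNReal.ofReal s)⁻¹ := by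
    calc _ ≤ ∫⁻ t in Ioc (0 : ℝ) 1, ENNReal.ofReal (t ^ (s - 1)) :=
          lintegral_mono fun t => mul_le_of_le_one_left (by positivity) prob_le_one
      _ = ENNReal.ofReal (∫ t in Ioc (0 : ℝ) 1, t ^ (s - 1)) := by
          rw [ofReal_integral_eq_lintegral_ofReal]
          · exact (intervalIntegrable_iff_integrableOn_Ioc_of_le zero_le_one).1
              (intervalIntegral.intervalIntegrable_rpow' (by linarith))
          · filter_upwards [ae_restrict_mem measurableSet_Ioc] with t ht
            exact Real.rpow_nonneg ht.1.le _
      _ = _ := by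
          rw [← intervalIntegral.integral_of_le zero_le_one, integral_rpow (Or.inl (by linarith))]
          simp [Real.zero_rpow hs.ne', ENNReal.ofReal_inv_of_pos hs]
  have h2 : ∫⁻ t in Ioi 1, π {x | t < g x} * ENNReal.ofReal (t ^ (s - 1))
      ≤ ∑ i, ∫⁻ t in Ioi 1, ENNReal.ofReal (φ i t) * ENNReal.ofReal (t ^ (s - 1)) := by
    have hmeas : ∀ i ∈ Finset.univ, AEMeasurable (fun t => ENNReal.ofReal (φ i t) *
        ENNReal.ofReal (t ^ (s - 1))) (volume.restrict (Ioi 1)) := fun i _ =>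
      ((hφ i).aemeasurable measurableSet_Ioi).ennreal_ofReal.mul
        (Measurable.aemeasurable (by fun_prop))
    rw [← lintegral_finsetSum' _ hmeas]
    · refine setLIntegral_mono' measurableSet_Ioi fun t ht => ?_
      have ht : 1 < t := ht
      have ht0 : 0 < t := by linarith
      rw [← Finset.sum_mul]
      gcongr
      have hφ0 : ∀ i, 0 ≤ φ i t := fun i => (truncMean_nonneg _).trans (hle i t ht)
      have hgt : ∀ x, 0 ≤ g x / t := fun x => div_nonneg (hg0 x) ht0.le
      rw [← ENNReal.ofReal_sum_of_nonneg fun i _ => hφ0 i]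
      calc π {x | t < g x} = ∫⁻ x, {x | t < g x}.indicator 1 x ∂π := by
            rw [lintegral_indicator_one (measurableSet_lt measurable_const hm)]
        _ ≤ ∫⁻ x, ENNReal.ofReal (truncPow p (g x / t)) ∂π := by
            refine lintegral_mono fun x => ?_
            by_cases hx : t < g x
            · rw [truncPow_of_one_lt ((one_lt_div ht0).2 hx)]
              simp [hx]
            · simp [hx]
        _ = ENNReal.ofReal (∫ x, truncPow p (g x / t) ∂π) := by
            rw [ofReal_integral_eq_lintegral_ofReal
              (integrable_truncPow_comp (hm.div_const t) hgt)
              (Eventually.of_forall fun x => truncPow_nonneg (hgt x))]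
        _ ≤ _ := by
            refine ENNReal.ofReal_le_ofReal (le_trans (le_of_eq ?_)
              ((integral_truncPow_ellNorm_le hp fun i => b i / t).trans
                (Finset.sum_le_sum fun i _ => hle i t ht)))
            refine integral_congr_ae (Eventually.of_forall fun x => ?_)
            simp only [hg, ← ellNorm_div hp ht0.le, div_mul_eq_mul_div]
  calc _ ≤ ENNReal.ofReal s * ((ENNReal.ofReal s)⁻¹ +
        ∑ i, ∫⁻ t in Ioi 1, ENNReal.ofReal (φ i t) * ENNReal.ofReal (t ^ (s - 1))) := by
        gcongr
        exact (lintegral_union_le _ _ _).trans (add_le_add h1 h2)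
    _ = _ := by
        rw [mul_add, ENNReal.mul_inv_cancel (by simpa using hs) ENNReal.ofReal_ne_top,
          Finset.mul_sum]

end Product

/-! ### The function t M'(t) - M(t) and the normalization of M -/

/-- `t M'(t) - M(t) = ∫_0^t u dM'(u)`. -/
def momentFun (M : ℝ → ℝ) (t : ℝ) : ℝ := t * deriv M t - M t

theorem hasDerivAt_iteratedDeriv_of_contDiffOn {M : ℝ → ℝ} {m k : ℕ} {s : Set ℝ} (hs : IsOpen s)
    (hM : ContDiffOn ℝ m M s) (hk : k < m) {t : ℝ} (ht : t ∈ s) :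
    HasDerivAt (iteratedDeriv k M) (iteratedDeriv (k + 1) M t) t := by
  have h1 := (hM.differentiableOn_iteratedDerivWithin (m := k) (by exact_mod_cast hk)
    hs.uniqueDiffOn t ht).differentiableAt (hs.mem_nhds ht)
  have h2 : iteratedDerivWithin k M s =ᶠ[𝓝 t] iteratedDeriv k M :=
    eventually_of_mem (hs.mem_nhds ht) fun x hx => iteratedDerivWithin_of_isOpen hs hx
  rw [iteratedDeriv_succ]
  exact (h2.differentiableAt_iff.1 h1).hasDerivAt

theorem continuousOn_iteratedDeriv_of_contDiffOn {M : ℝ → ℝ} {m k : ℕ} {s : Set ℝ} (hs : IsOpen s)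
    (hM : ContDiffOn ℝ m M s) (hk : k ≤ m) : ContinuousOn (iteratedDeriv k M) s :=
  (hM.continuousOn_iteratedDerivWithin (by exact_mod_cast hk) hs.uniqueDiffOn).congr
    fun _ hx => (iteratedDerivWithin_of_isOpen hs hx).symm

/-- The hypotheses on `M` that do not involve the exponent `q`. -/
structure IsAdmissibleOrlicz (p : ℝ≥0∞) (M : ℝ → ℝ) : Prop where
  orlicz : IsOrliczFunction M
  normalized : IsNormalizedOrlicz M
  contDiffOn : ContDiffOn ℝ 3 M (Ioi 0)
  hasDerivWithinAt_zero : HasDerivWithinAt M 0 (Ici 0) 0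
  eventually_affine : ∃ T : ℝ, 0 < T ∧ ∃ α β : ℝ, ∀ t, T ≤ t → M t = α * t + β
  density_nonneg : ∀ s : ℝ, 0 < s → 0 ≤ orliczDensity p M s

namespace IsAdmissibleOrlicz

variable {p : ℝ≥0∞} {M : ℝ → ℝ} (h : IsAdmissibleOrlicz p M)
include h

theorem nonneg {t : ℝ} (ht : 0 ≤ t) : 0 ≤ M t := by
  rcases ht.eq_or_lt with rfl | ht
  · rw [h.orlicz.map_zero]
  · exact (h.orlicz.pos t ht).le

theorem hasDerivAt {t : ℝ} (ht : 0 < t) : HasDerivAt M (deriv M t) t := by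
  simpa using hasDerivAt_iteratedDeriv_of_contDiffOn isOpen_Ioi (m := 3) (k := 0)
    h.contDiffOn (by norm_num) ht

theorem hasDerivAt_deriv {t : ℝ} (ht : 0 < t) :
    HasDerivAt (deriv M) (iteratedDeriv 2 M t) t := by
  simpa using hasDerivAt_iteratedDeriv_of_contDiffOn isOpen_Ioi (m := 3) (k := 1)
    h.contDiffOn (by norm_num) ht

theorem hasDerivAt_deriv_two {t : ℝ} (ht : 0 < t) :
    HasDerivAt (iteratedDeriv 2 M) (iteratedDeriv 3 M t) t :=
  hasDerivAt_iteratedDeriv_of_contDiffOn isOpen_Ioi (m := 3) (k := 2)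
    h.contDiffOn (by norm_num) ht

theorem momentFun_nonneg {t : ℝ} (ht : 0 < t) : 0 ≤ momentFun M t := by
  have := h.orlicz.convexOn.slope_le_of_hasDerivAt (mem_Ici.2 le_rfl) (mem_Ici.2 ht.le) ht
    (h.hasDerivAt ht)
  rw [slope_def_field, h.orlicz.map_zero, sub_zero, sub_zero, div_le_iff₀ ht] at this
  rw [momentFun]
  linarith

theorem momentFun_zero : momentFun M 0 = 0 := by
  simp [momentFun, h.orlicz.map_zero]

/-- The tangent at t lies below M at 2t, so t M'(t) ≤ M(2t) - M(t). -/
theorem momentFun_le {t : ℝ} (ht : 0 ≤ t) : momentFun M t ≤ M (2 * t) := by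
  rcases ht.eq_or_lt with rfl | ht
  · simp [h.momentFun_zero, h.orlicz.map_zero]
  have := h.orlicz.convexOn.le_slope_of_hasDerivAt (mem_Ici.2 ht.le)
    (mem_Ici.2 (show (0 : ℝ) ≤ 2 * t by linarith)) (by linarith) (h.hasDerivAt ht)
  rw [slope_def_field, le_div_iff₀ (by linarith)] at this
  rw [momentFun]
  linarith [h.nonneg ht.le]

theorem continuousOn : ContinuousOn M (Ici 0) := by
  intro t ht
  rcases (mem_Ici.1 ht).eq_or_lt with rfl | ht
  · exact h.hasDerivWithinAt_zero.continuousWithinAt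
  · exact (h.hasDerivAt ht).continuousAt.continuousWithinAt

theorem tendsto_zero : Tendsto M (𝓝[>] 0) (𝓝 0) := by
  have := h.hasDerivWithinAt_zero.continuousWithinAt.mono Ioi_subset_Ici_self
  rwa [ContinuousWithinAt, h.orlicz.map_zero] at this

theorem tendsto_momentFun_zero : Tendsto (momentFun M) (𝓝[>] 0) (𝓝 0) := by
  have h2 : Tendsto (fun t : ℝ => 2 * t) (𝓝[>] 0) (𝓝[>] 0) := by
    refine tendsto_nhdsWithin_iff.2 ⟨?_, ?_⟩
    · exact ((continuous_const.mul continuous_id).tendsto' 0 0 (by simp)).mono_left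
        nhdsWithin_le_nhds
    · filter_upwards [self_mem_nhdsWithin] with t ht
      have : 0 < t := ht
      exact mem_Ioi.2 (by linarith)
  refine tendsto_of_tendsto_of_tendsto_of_le_of_le' tendsto_const_nhds (h.tendsto_zero.comp h2)
    ?_ ?_
  · filter_upwards [self_mem_nhdsWithin] with t ht using h.momentFun_nonneg ht
  · filter_upwards [self_mem_nhdsWithin] with t ht using h.momentFun_le (le_of_lt ht)

theorem continuousOn_momentFun : ContinuousOn (momentFun M) (Ioi 0) := fun _ ht =>
  ((continuousAt_id.mul (h.hasDerivAt_deriv ht).continuousAt).sub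
    (h.hasDerivAt ht).continuousAt).continuousWithinAt

theorem hasDerivAt_momentFun {t : ℝ} (ht : 0 < t) :
    HasDerivAt (momentFun M) (t * iteratedDeriv 2 M t) t := by
  have := ((hasDerivAt_id t).mul (h.hasDerivAt_deriv ht)).sub (h.hasDerivAt ht)
  refine this.congr_deriv ?_
  simp

/-- Beyond some point the second and third derivatives vanish and `t M'(t) - M(t) = 1`. -/
theorem exists_affine : ∃ T : ℝ, 0 < T ∧ ∀ t, T < t →
    momentFun M t = 1 ∧ iteratedDeriv 2 M t = 0 ∧ iteratedDeriv 3 M t = 0 := by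
  obtain ⟨T, hT, α, β, hM⟩ := h.eventually_affine
  have hev : ∀ t, T < t → M =ᶠ[𝓝 t] fun t => α * t + β := fun t ht =>
    eventually_of_mem (Ioi_mem_nhds ht) fun x hx => hM x (le_of_lt hx)
  have hd1 : ∀ t, T < t → deriv M t = α := fun t ht => by
    rw [(hev t ht).deriv_eq]
    simp
  have hd2 : ∀ t, T < t → iteratedDeriv 2 M t = 0 := fun t ht => by
    have : deriv M =ᶠ[𝓝 t] fun _ => α :=
      eventually_of_mem (Ioi_mem_nhds ht) fun x hx => hd1 x hx
    rw [iteratedDeriv_succ, iteratedDeriv_one, this.deriv_eq]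
    simp
  have hd3 : ∀ t, T < t → iteratedDeriv 3 M t = 0 := fun t ht => by
    have : iteratedDeriv 2 M =ᶠ[𝓝 t] fun _ => 0 :=
      eventually_of_mem (Ioi_mem_nhds ht) fun x hx => hd2 x hx
    rw [iteratedDeriv_succ, this.deriv_eq]
    simp
  -- On the affine part t M'(t) - M(t) = -β, so the normalization has to give -β = 1. By layer cake,
  -- ∫ x dM'(x) = ∫_0^∞ (α - M'(t)) dt, and the primitive αt - M(t) runs from 0 to -β.
  suffices hβ : -β = 1 by
    refine ⟨T, hT, fun t ht => ⟨?_, hd2 t ht, hd3 t ht⟩⟩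
    rw [momentFun, hd1 t ht, hM t ht.le]
    linarith
  obtain ⟨F, hF, hint⟩ := h.normalized
  have hF' : ∀ x, 0 < x → F x = deriv M x := fun x hx => by
    rw [hF x hx.le]
    exact (h.hasDerivAt hx).hasDerivWithinAt.derivWithin (uniqueDiffWithinAt_Ioi x)
  have hlim : Tendsto F atTop (𝓝 α) := by
    refine tendsto_const_nhds.congr' ?_
    filter_upwards [eventually_gt_atTop T] with t ht
    rw [hF' t (hT.trans ht), hd1 t ht]
  have hle : ∀ x, F x ≤ α := fun x => F.mono.ge_of_tendsto hlim x
  rw [lintegral_eq_lintegral_meas_lt (f := fun x => x) _ (by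
    filter_upwards [ae_restrict_mem measurableSet_Ioi] with t ht using le_of_lt ht)
    measurable_id'.aemeasurable] at hint
  have hg : ∫⁻ t in Ioi (0 : ℝ), (F.measure.restrict (Ioi 0)) {x | t < x}
      = ∫⁻ t in Ioi (0 : ℝ), ENNReal.ofReal (α - deriv M t) := by
    refine setLIntegral_congr_fun measurableSet_Ioi fun t ht => ?_
    have ht : 0 < t := ht
    change (F.measure.restrict (Ioi 0)) (Ioi t) = _
    rw [Measure.restrict_apply measurableSet_Ioi, inter_eq_left.2 (Ioi_subset_Ioi ht.le),
      F.measure_Ioi hlim, hF' t ht]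
  have hc : ContinuousWithinAt (fun t => α * t - M t) (Ici 0) 0 :=
    (continuousWithinAt_const.mul continuousWithinAt_id).sub (h.continuousOn 0 (mem_Ici.2 le_rfl))
  have hder : ∀ t ∈ Ioi (0 : ℝ), HasDerivAt (fun t => α * t - M t) (α - deriv M t) t :=
    fun t ht => by
      refine (((hasDerivAt_id t).const_mul α).sub (h.hasDerivAt ht)).congr_deriv ?_
      simp
  have hpos : ∀ t ∈ Ioi (0 : ℝ), 0 ≤ α - deriv M t := fun t ht => by
    rw [← hF' t ht]
    linarith [hle t]
  have hlim2 : Tendsto (fun t => α * t - M t) atTop (𝓝 (-β)) := by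
    refine tendsto_const_nhds.congr' ?_
    filter_upwards [eventually_ge_atTop T] with t ht
    rw [hM t ht]
    ring
  rw [hg, ← ofReal_integral_eq_lintegral_ofReal
    (integrableOn_Ioi_deriv_of_nonneg hc hder hpos hlim2)
    (by filter_upwards [ae_restrict_mem measurableSet_Ioi] with t ht using hpos t ht),
    integral_Ioi_of_hasDerivAt_of_nonneg hc hder hpos hlim2, h.orlicz.map_zero] at hint
  simpa using hint

end IsAdmissibleOrlicz

/-! ### The Orlicz density: tail, total mass and truncated mean -/

/-- The tail function `s ↦ P(X > s)` of the density `orliczDensity p M`. -/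
def orliczTail (p : ℝ≥0∞) (M : ℝ → ℝ) (s : ℝ) : ℝ :=
  momentFun M s⁻¹ - (p⁻¹).toReal * (s ^ 2)⁻¹ * iteratedDeriv 2 M s⁻¹

theorem measurable_orliczDensity (p : ℝ≥0∞) (M : ℝ → ℝ) : Measurable (orliczDensity p M) := by
  have hm : ∀ k, Measurable fun s => iteratedDeriv (k + 1) M s⁻¹ := fun k => by
    rw [iteratedDeriv_succ]
    exact (measurable_deriv _).comp measurable_inv
  have h2 := hm 1
  have h3 := hm 2
  refine Measurable.ite measurableSet_Ioi ?_ measurable_const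
  norm_num at h2 h3
  fun_prop

theorem lintegral_density_mul {p : ℝ≥0∞} {M : ℝ → ℝ} {s : ℝ} (hs : ∀ x ≤ s, orliczDensity p M x = 0)
    (g : ℝ → ℝ≥0∞) :
    ∫⁻ x, ENNReal.ofReal (orliczDensity p M x) * g x
      = ∫⁻ x in Ioi s, ENNReal.ofReal (orliczDensity p M x) * g x := by
  rw [← setLIntegral_eq_of_support_subset]
  intro x hx
  by_contra hc
  rw [mem_Ioi, not_lt] at hc
  simp [hs x hc] at hx

namespace IsAdmissibleOrlicz

variable {p : ℝ≥0∞} {M : ℝ → ℝ} (h : IsAdmissibleOrlicz p M)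
include h

theorem density_nonneg' (s : ℝ) : 0 ≤ orliczDensity p M s := by
  rcases lt_or_ge 0 s with hs | hs
  · exact h.density_nonneg s hs
  · rw [orliczDensity, if_neg hs.not_gt]

theorem continuousOn_density : ContinuousOn (orliczDensity p M) (Ioi 0) := by
  have h2 := continuousOn_iteratedDeriv_of_contDiffOn isOpen_Ioi (m := 3) (k := 2)
    h.contDiffOn (by norm_num)
  have h3 := continuousOn_iteratedDeriv_of_contDiffOn isOpen_Ioi (m := 3) (k := 3)
    h.contDiffOn (by norm_num)
  have hinv : ContinuousOn (fun s : ℝ => s⁻¹) (Ioi 0) :=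
    continuousOn_inv₀.mono fun x hx => (ne_of_gt hx : x ≠ 0)
  have hmaps : MapsTo (fun s : ℝ => s⁻¹) (Ioi 0) (Ioi 0) := fun s hs =>
    mem_Ioi.2 (inv_pos.2 hs)
  have hpow : ∀ k : ℕ, ContinuousOn (fun s : ℝ => (s ^ k)⁻¹) (Ioi 0) := fun k =>
    (continuousOn_pow k).inv₀ fun x hx => (pow_pos hx k).ne'
  refine ContinuousOn.congr (f := fun s => (1 - 2 * (p⁻¹).toReal) * (s ^ 3)⁻¹ *
    iteratedDeriv 2 M s⁻¹ - (p⁻¹).toReal * (s ^ 4)⁻¹ * iteratedDeriv 3 M s⁻¹) ?_ ?_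
  · exact ((continuousOn_const.mul (hpow 3)).mul (h2.comp hinv hmaps)).sub
      ((continuousOn_const.mul (hpow 4)).mul (h3.comp hinv hmaps))
  · intro s hs
    exact if_pos hs

theorem hasDerivAt_tail {s : ℝ} (hs : 0 < s) :
    HasDerivAt (orliczTail p M) (-orliczDensity p M s) s := by
  have hi : HasDerivAt (fun s : ℝ => s⁻¹) (-(s ^ 2)⁻¹) s := hasDerivAt_inv hs.ne'
  have h1 := (h.hasDerivAt_momentFun (inv_pos.2 hs)).comp s hi
  have h2 := (h.hasDerivAt_deriv_two (inv_pos.2 hs)).comp s hi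
  have h3 := ((hasDerivAt_pow 2 s).inv (pow_pos hs 2).ne').const_mul (p⁻¹).toReal
  refine (h1.sub (h3.mul h2)).congr_deriv ?_
  rw [orliczDensity, if_pos hs]
  simp only [Function.comp, Pi.inv_apply]
  field_simp
  ring

theorem antitoneOn_tail : AntitoneOn (orliczTail p M) (Ioi 0) := by
  refine antitoneOn_of_hasDerivWithinAt_nonpos (f' := fun s => -orliczDensity p M s)
    (convex_Ioi 0) (fun s hs => (h.hasDerivAt_tail hs).continuousAt.continuousWithinAt) ?_ ?_
  · intro s hs
    rw [interior_Ioi] at hs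
    exact (h.hasDerivAt_tail hs).hasDerivWithinAt
  · intro s hs
    linarith [h.density_nonneg' s]

/-- No pointwise bound on u² M''(u) near 0 is at hand, but the mean value theorem for M' on [t/2, t]
supplies one point v where it is small. Smallness of the tail at arbitrarily large points is enough,
because the tail is monotone. -/
theorem exists_abs_tail_lt {ε s : ℝ} (hε : 0 < ε) (hs : 0 < s) :
    ∃ u, s ≤ u ∧ |orliczTail p M u| < ε := by
  set c := (p⁻¹).toReal
  have hc : 0 ≤ c := ENNReal.toReal_nonneg
  have hev : ∀ᶠ t in 𝓝[>] (0 : ℝ), ∀ u ∈ Ioc 0 t,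
      |momentFun M u| < ε / (1 + 12 * c) ∧ |M u| < ε / (1 + 12 * c) := by
    have h1 : ∀ᶠ u in 𝓝[>] (0 : ℝ), |momentFun M u| < ε / (1 + 12 * c) ∧
        |M u| < ε / (1 + 12 * c) := by
      have e1 := h.tendsto_momentFun_zero.abs.eventually
        (gt_mem_nhds (show |(0 : ℝ)| < ε / (1 + 12 * c) by rw [abs_zero]; positivity))
      have e2 := h.tendsto_zero.abs.eventually
        (gt_mem_nhds (show |(0 : ℝ)| < ε / (1 + 12 * c) by rw [abs_zero]; positivity))
      exact e1.and e2
    obtain ⟨d, hd, hsub⟩ := mem_nhdsGT_iff_exists_Ioo_subset.1 h1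
    filter_upwards [Ioo_mem_nhdsGT hd] with t ht u hu
    exact hsub ⟨hu.1, hu.2.trans_lt ht.2⟩
  obtain ⟨t, ht, ht0, hts⟩ := (hev.and (Ioo_mem_nhdsGT (inv_pos.2 hs))).exists
  obtain ⟨v, hv, hslope⟩ := exists_hasDerivAt_eq_slope (deriv M) (iteratedDeriv 2 M)
    (show t / 2 < t by linarith)
    (fun x hx => (h.hasDerivAt_deriv (by linarith [hx.1])).continuousAt.continuousWithinAt)
    (fun x hx => h.hasDerivAt_deriv (by linarith [hx.1]))
  have hv0 : 0 < v := by linarith [hv.1]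
  have hvt := hv.2
  refine ⟨v⁻¹, ?_, ?_⟩
  · rw [le_inv_comm₀ hs hv0]
    linarith
  set δ := ε / (1 + 12 * c) with hδ
  have hεδ : δ + c * (12 * δ) = ε := by rw [hδ]; field_simp
  obtain ⟨a1, a2⟩ := ht t ⟨ht0, le_rfl⟩
  obtain ⟨b1, b2⟩ := ht (t / 2) ⟨by linarith, by linarith⟩
  obtain ⟨d1, -⟩ := ht v ⟨hv0, hvt.le⟩
  have hδ0 : 0 < δ := (abs_nonneg _).trans_lt d1
  -- At x = t and x = t/2, x M'(x) is the sum of `momentFun M x` and M(x), each less than δ in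
  -- absolute value. The weights 2 and 4 therefore give 2·2δ + 4·2δ = 12δ.
  have hbound : |v ^ 2 * iteratedDeriv 2 M v| ≤ 12 * δ := by
    have hX : t ^ 2 * iteratedDeriv 2 M v = 2 * (t * deriv M t) - 4 * (t / 2 * deriv M (t / 2)) := by
      rw [hslope]
      field_simp
      ring
    calc |v ^ 2 * iteratedDeriv 2 M v| ≤ |t ^ 2 * iteratedDeriv 2 M v| := by
          rw [abs_mul, abs_mul, abs_of_nonneg (sq_nonneg v), abs_of_nonneg (sq_nonneg t)]
          gcongr
      _ ≤ _ := by
          rw [hX]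
          rw [momentFun, abs_lt] at a1 b1
          rw [abs_lt] at a2 b2
          exact abs_le.2 ⟨by linarith [a1.1, a2.1, b1.2, b2.2],
            by linarith [a1.2, a2.2, b1.1, b2.1]⟩
  rw [orliczTail, inv_inv, inv_pow, inv_inv, mul_assoc]
  calc _ ≤ |momentFun M v| + |c * (v ^ 2 * iteratedDeriv 2 M v)| := abs_sub _ _
    _ < δ + c * (12 * δ) := by
        refine add_lt_add_of_lt_of_le d1 ?_
        rw [abs_mul, abs_of_nonneg hc]
        gcongr
    _ = ε := hεδ

theorem tail_nonneg {s : ℝ} (hs : 0 < s) : 0 ≤ orliczTail p M s := by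
  refine le_of_forall_pos_lt_add fun ε hε => ?_
  obtain ⟨u, hu, hlt⟩ := h.exists_abs_tail_lt hε hs
  linarith [h.antitoneOn_tail hs (hs.trans_le hu : 0 < u) hu, (abs_lt.1 hlt).1]

theorem tendsto_tail : Tendsto (orliczTail p M) atTop (𝓝 0) := by
  refine Metric.tendsto_atTop.2 fun ε hε => ?_
  obtain ⟨u, hu, hlt⟩ := h.exists_abs_tail_lt hε one_pos
  have hu0 : 0 < u := one_pos.trans_le hu
  refine ⟨u, fun s hs => ?_⟩
  have hs0 : 0 < s := hu0.trans_le hs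
  rw [Real.dist_0_eq_abs, abs_of_nonneg (h.tail_nonneg hs0)]
  exact (h.antitoneOn_tail hu0 hs0 hs).trans_lt ((le_abs_self _).trans_lt hlt)

theorem lintegral_Ioi_density {s : ℝ} (hs : 0 < s) :
    ∫⁻ x in Ioi s, ENNReal.ofReal (orliczDensity p M x) = ENNReal.ofReal (orliczTail p M s) := by
  have hc := (h.hasDerivAt_tail hs).neg.continuousAt.continuousWithinAt (s := Ici s)
  have hd : ∀ x ∈ Ioi s, HasDerivAt (-orliczTail p M) (orliczDensity p M x) x := fun x hx => by
    simpa using (h.hasDerivAt_tail (hs.trans hx)).neg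
  have h0 : ∀ x ∈ Ioi s, 0 ≤ orliczDensity p M x := fun x _ => h.density_nonneg' x
  have hl : Tendsto (-orliczTail p M) atTop (𝓝 0) := by
    rw [← neg_zero]
    exact h.tendsto_tail.neg
  rw [← ofReal_integral_eq_lintegral_ofReal (integrableOn_Ioi_deriv_of_nonneg hc hd h0 hl)
    (Eventually.of_forall h.density_nonneg'), integral_Ioi_of_hasDerivAt_of_nonneg hc hd h0 hl]
  simp

/-- The density vanishes near `0`, and the tail function is `1` there. -/
theorem exists_density_eq_zero : ∃ s₀ : ℝ, 0 < s₀ ∧ ∀ s ≤ s₀, orliczDensity p M s = 0 ∧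
    (0 < s → orliczTail p M s = 1 ∧ iteratedDeriv 2 M s⁻¹ = 0) := by
  obtain ⟨T, hT, haff⟩ := h.exists_affine
  refine ⟨(2 * T)⁻¹, by positivity, fun s hs => ?_⟩
  rcases le_or_gt s 0 with hs0 | hs0
  · exact ⟨if_neg hs0.not_gt, fun hc => absurd hc hs0.not_gt⟩
  · have hsT : T < s⁻¹ := by
      rw [le_inv_comm₀ hs0 (by positivity)] at hs
      linarith
    obtain ⟨e1, e2, e3⟩ := haff _ hsT
    refine ⟨?_, fun _ => ⟨?_, e2⟩⟩
    · rw [orliczDensity, e2, e3]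
      simp
    · rw [orliczTail, e1, e2]
      simp

theorem isProbabilityDensity : IsProbabilityDensity (orliczDensity p M) := by
  refine ⟨measurable_orliczDensity p M, h.density_nonneg', ?_⟩
  obtain ⟨s, hs, hs'⟩ := h.exists_density_eq_zero
  have := lintegral_density_mul (fun x hx => (hs' x hx).1) fun _ => 1
  simp only [mul_one] at this
  rw [this, h.lintegral_Ioi_density hs, ((hs' s le_rfl).2 hs).1, ENNReal.ofReal_one]

/-- The two terms of the density are arranged so that s^p f(s) has an explicit primitive; here r is
the real value of a finite p. -/
theorem hasDerivAt_rpow_mul_deriv_two {r s : ℝ} (hpr : (p⁻¹).toReal * r = 1) (hs : 0 < s) :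
    HasDerivAt (fun s => (p⁻¹).toReal * (s ^ (r - 2) * iteratedDeriv 2 M s⁻¹))
      (s ^ r * orliczDensity p M s) s := by
  have hi : HasDerivAt (fun s : ℝ => s⁻¹) (-(s ^ 2)⁻¹) s := hasDerivAt_inv hs.ne'
  have h1 := (h.hasDerivAt_deriv_two (inv_pos.2 hs)).comp s hi
  have h2 := Real.hasDerivAt_rpow_const (x := s) (p := r - 2) (Or.inl hs.ne')
  refine ((h2.mul h1).const_mul (p⁻¹).toReal).congr_deriv ?_
  have e1 : s ^ (r - 2) = s ^ r * (s ^ 2)⁻¹ := by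
    rw [Real.rpow_sub hs, Real.rpow_two, div_eq_mul_inv]
  have e2 : s ^ (r - 2 - 1) = s ^ r * (s ^ 3)⁻¹ := by
    rw [show r - 2 - 1 = r - (3 : ℕ) by norm_num; ring, Real.rpow_sub hs, Real.rpow_natCast,
      div_eq_mul_inv]
  rw [orliczDensity, if_pos hs, e1, e2]
  have e3 : 1 - 2 * (p⁻¹).toReal = (p⁻¹).toReal * (r - 2) := by linear_combination -hpr
  rw [e3]
  simp only [Function.comp]
  field_simp
  ring

/-- Split at x = 1/b. Above it the truncated power is 1 and the tail contributes `momentFun M b`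
minus (1/p) b² M''(b). Below it the integral of (bx)^p f(x) is exactly (1/p) b² M''(b), and the two
corrections cancel. For p = ∞ both corrections are zero. -/
theorem lintegral_density_mul_truncPow (hp : 1 ≤ p) {b : ℝ} (hb : 0 < b) :
    ∫⁻ x, ENNReal.ofReal (orliczDensity p M x) * ENNReal.ofReal (truncPow p |b * x|)
      = ENNReal.ofReal (momentFun M b) := by
  obtain ⟨s₀, hs₀, hs₀'⟩ := h.exists_density_eq_zero
  -- The lower limit lies where f and M''(1/s) already vanish, so the primitive has no boundary term
  -- there; the minimum keeps it at most 1/b.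
  set s := min s₀ b⁻¹ with hsdef
  have hs : 0 < s := lt_min hs₀ (inv_pos.2 hb)
  have hs' := fun x (hx : x ≤ s) => hs₀' x (hx.trans (min_le_left _ _))
  have hsb : s ≤ b⁻¹ := min_le_right _ _
  have hb' : 0 < b⁻¹ := inv_pos.2 hb
  rw [lintegral_density_mul (fun x hx => (hs' x hx).1), ← Ioc_union_Ioi_eq_Ioi hsb,
    lintegral_union measurableSet_Ioi (Ioc_disjoint_Ioi le_rfl)]
  have htail : ∫⁻ x in Ioi b⁻¹, ENNReal.ofReal (orliczDensity p M x) *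
      ENNReal.ofReal (truncPow p |b * x|) = ENNReal.ofReal (orliczTail p M b⁻¹) := by
    rw [← h.lintegral_Ioi_density hb']
    refine setLIntegral_congr_fun measurableSet_Ioi fun x hx => ?_
    have hx : b⁻¹ < x := hx
    have : 1 < b * x := by rwa [inv_lt_iff_one_lt_mul₀' hb] at hx
    rw [abs_of_pos (by linarith), truncPow_of_one_lt this, ENNReal.ofReal_one, mul_one]
  have hhead : ∫⁻ x in Ioc s b⁻¹, ENNReal.ofReal (orliczDensity p M x) *
      ENNReal.ofReal (truncPow p |b * x|)
      = ENNReal.ofReal ((p⁻¹).toReal * (b ^ 2 * iteratedDeriv 2 M b)) ∧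
      0 ≤ (p⁻¹).toReal * (b ^ 2 * iteratedDeriv 2 M b) := by
    rcases eq_or_ne p ∞ with rfl | hp'
    · simp only [ENNReal.inv_top, ENNReal.toReal_zero, zero_mul, ENNReal.ofReal_zero, le_refl,
        and_true]
      rw [setLIntegral_congr_fun (g := fun _ => 0) measurableSet_Ioc]
      · simp
      · intro x hx
        have : b * x ≤ 1 := by
          have := mul_le_mul_of_nonneg_left hx.2 hb.le
          rwa [mul_inv_cancel₀ hb.ne'] at this
        have h0 : 0 < b * x := mul_pos hb (hs.trans hx.1)
        simp [truncPow, abs_of_pos h0, this.not_gt]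
    · set r := p.toReal with hr
      have hr0 : 0 < r := ENNReal.toReal_pos (by positivity) hp'
      have hpr : (p⁻¹).toReal * r = 1 := by
        rw [ENNReal.toReal_inv, inv_mul_cancel₀ hr0.ne']
      have hpt : ∀ x ∈ Ioc s b⁻¹, ENNReal.ofReal (orliczDensity p M x) *
          ENNReal.ofReal (truncPow p |b * x|)
          = ENNReal.ofReal (b ^ r * (x ^ r * orliczDensity p M x)) := fun x hx => by
        have hx0 : 0 < x := hs.trans hx.1
        have h1 : b * x ≤ 1 := by
          have := mul_le_mul_of_nonneg_left hx.2 hb.le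
          rwa [mul_inv_cancel₀ hb.ne'] at this
        have h0 : 0 < b * x := mul_pos hb hx0
        rw [← ENNReal.ofReal_mul (h.density_nonneg' x), truncPow, if_neg hp', abs_of_pos h0,
          min_eq_right (Real.rpow_le_one h0.le h1 hr0.le), Real.mul_rpow hb.le hx0.le]
        congr 1
        ring
      have hcont : ContinuousOn (fun x => b ^ r * (x ^ r * orliczDensity p M x)) (Icc s b⁻¹) := by
        refine continuousOn_const.mul (ContinuousOn.mul ?_ (h.continuousOn_density.mono
          fun x hx => hs.trans_le hx.1))
        exact fun x hx => (Real.continuousAt_rpow_const _ _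
          (Or.inl (hs.trans_le hx.1).ne')).continuousWithinAt
      have hnn : 0 ≤ᵐ[volume.restrict (Ioc s b⁻¹)]
          fun x => b ^ r * (x ^ r * orliczDensity p M x) := by
        filter_upwards [ae_restrict_mem measurableSet_Ioc] with x hx
        have hx0 : 0 < x := hs.trans hx.1
        have := h.density_nonneg' x
        show 0 ≤ b ^ r * (x ^ r * orliczDensity p M x)
        positivity
      have hval : ∫ x in Ioc s b⁻¹, b ^ r * (x ^ r * orliczDensity p M x)
          = (p⁻¹).toReal * (b ^ 2 * iteratedDeriv 2 M b) := by
        rw [← intervalIntegral.integral_of_le hsb,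
          intervalIntegral.integral_eq_sub_of_hasDerivAt (f := fun s => b ^ r *
            ((p⁻¹).toReal * (s ^ (r - 2) * iteratedDeriv 2 M s⁻¹)))]
        · rw [((hs' s le_rfl).2 hs).2, inv_inv, Real.inv_rpow hb.le, ← Real.rpow_neg hb.le]
          have : b ^ r * b ^ (-(r - 2)) = b ^ 2 := by
            rw [← Real.rpow_add hb, ← Real.rpow_two]
            congr 1
            ring
          rw [← this]
          ring
        · intro x hx
          rw [uIcc_of_le hsb] at hx
          exact (h.hasDerivAt_rpow_mul_deriv_two hpr (hs.trans_le hx.1)).const_mul _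
        · exact hcont.intervalIntegrable_of_Icc hsb
      refine ⟨?_, ?_⟩
      · rw [setLIntegral_congr_fun measurableSet_Ioc hpt, ← hval,
          ofReal_integral_eq_lintegral_ofReal
            ((hcont.integrableOn_Icc).mono_set Ioc_subset_Icc_self) hnn]
      · rw [← hval]
        exact integral_nonneg_of_ae hnn
  rw [htail, hhead.1, ← ENNReal.ofReal_add hhead.2 (h.tail_nonneg hb')]
  congr 1
  rw [orliczTail, inv_inv, inv_pow, inv_inv]
  ring

theorem isProbabilityMeasure : IsProbabilityMeasure (lawOfDensity (orliczDensity p M)) :=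
  ⟨by simpa [lawOfDensity] using h.isProbabilityDensity.lintegral_eq_one⟩

theorem truncMean_eq (hp : 1 ≤ p) (a : ℝ) :
    truncMean p (lawOfDensity (orliczDensity p M)) a = momentFun M |a| := by
  have := h.isProbabilityMeasure
  have hnn : 0 ≤ momentFun M |a| := by
    rcases (abs_nonneg a).eq_or_lt with ha | ha
    · rw [← ha, h.momentFun_zero]
    · exact h.momentFun_nonneg ha
  rw [truncMean, integral_eq_lintegral_of_nonneg_ae
    (Eventually.of_forall fun x => truncPow_nonneg (abs_nonneg _))
    (integrable_truncPow_abs_mul a).aestronglyMeasurable]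
  have hm : Measurable fun x => ENNReal.ofReal (truncPow p |a * x|) :=
    (measurable_truncPow.comp (by fun_prop)).ennreal_ofReal
  rw [lawOfDensity, lintegral_withDensity_eq_lintegral_mul _
    (measurable_orliczDensity p M).ennreal_ofReal hm]
  rcases (abs_nonneg a).eq_or_lt with ha | ha
  · rw [← ha, h.momentFun_zero]
    have h0 : truncPow p 0 = 0 :=
      le_antisymm (truncPow_le_self hp le_rfl) (truncPow_nonneg le_rfl)
    simp [abs_eq_zero.1 ha.symm, h0]
  · simp only [Pi.mul_apply]
    have hab : ∀ x, |(|a|) * x| = |a * x| := fun x => by rw [abs_mul, abs_abs, abs_mul]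
    have := h.lintegral_density_mul_truncPow hp ha
    simp only [hab] at this
    rw [this, ENNReal.toReal_ofReal hnn]

end IsAdmissibleOrlicz

/-! ### Moments of the ℓ_p norm under the Orlicz law -/

/-- The substitution u = c/t turns the layer-cake integral of a q-th moment into the integral in the
growth condition. -/
theorem lintegral_comp_div_mul_rpow (M : ℝ → ℝ) (q : ℝ) {c : ℝ} (hc : 0 < c) :
    ∫⁻ t in Ioi 1, ENNReal.ofReal (M (c / t)) * ENNReal.ofReal (t ^ (q - 1))
      = ENNReal.ofReal (c ^ q) * ∫⁻ u in Ioo 0 c, ENNReal.ofReal (M u / u ^ q / u) := by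
  have himg : (fun t => c / t) '' Ioi 1 = Ioo 0 c := by
    ext u
    simp only [mem_image, mem_Ioi, mem_Ioo]
    constructor
    · rintro ⟨t, ht, rfl⟩
      exact ⟨by positivity, div_lt_self hc ht⟩
    · rintro ⟨hu, huc⟩
      exact ⟨c / u, (one_lt_div hu).2 huc, by field_simp⟩
  rw [← himg, lintegral_image_eq_lintegral_abs_deriv_mul (f' := fun t => -(c / t ^ 2))
    measurableSet_Ioi, ← lintegral_const_mul' _ _ ENNReal.ofReal_ne_top]
  · refine setLIntegral_congr_fun measurableSet_Ioi fun t ht => ?_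
    have ht : 0 < t := one_pos.trans ht
    rw [abs_neg, abs_of_pos (show 0 < c / t ^ 2 by positivity),
      ← ENNReal.ofReal_mul' (show 0 ≤ t ^ (q - 1) by positivity),
      ← ENNReal.ofReal_mul (show 0 ≤ c / t ^ 2 by positivity),
      ← ENNReal.ofReal_mul (show 0 ≤ c ^ q by positivity)]
    congr 1
    have h2 : t ^ (q - 1) = t ^ q / t := by rw [Real.rpow_sub_one ht.ne']
    rw [Real.div_rpow hc.le ht.le, h2]
    have := Real.rpow_pos_of_pos hc q
    have := Real.rpow_pos_of_pos ht q
    field_simp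
  · intro t ht
    have ht : t ≠ 0 := (one_pos.trans ht).ne'
    refine ((hasDerivAt_inv ht).const_mul c).hasDerivWithinAt.congr_deriv ?_ |>.congr_of_eventuallyEq
      (Eventually.of_forall fun x => div_eq_mul_inv _ _) (div_eq_mul_inv _ _)
    ring
  · intro x hx y hy hxy
    have hx : x ≠ 0 := (one_pos.trans hx).ne'
    have hy : y ≠ 0 := (one_pos.trans hy).ne'
    simp only at hxy
    field_simp at hxy
    exact hxy.symm

theorem ellNorm_div_mul {p : ℝ≥0∞} (hp : 1 ≤ p) {ι : Type*} [Fintype ι] {t : ℝ} (ht : 0 ≤ t)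
    (b x : ι → ℝ) : ellNorm p (fun i => b i / t * x i) = ellNorm p (fun i => b i * x i) / t := by
  simp only [← ellNorm_div hp ht, div_mul_eq_mul_div]

/-- On [0, 1] the concave function 1 - exp(-m) lies above its chord. -/
theorem mul_one_sub_exp_neg_one_le {m : ℝ} (h0 : 0 ≤ m) (h1 : m ≤ 1) :
    (1 - Real.exp (-1)) * m ≤ 1 - Real.exp (-m) := by
  have := convexOn_exp.2 (mem_univ (-1)) (mem_univ 0) h0 (sub_nonneg.2 h1) (by ring)
  simp only [smul_eq_mul, mul_zero, add_zero, Real.exp_zero, mul_one, mul_neg] at this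
  linarith

theorem exp_neg_one_lt_one : Real.exp (-1) < 1 := by
  simp

theorem luxemburgNorm_nonneg (M : ℝ → ℝ) {ι : Type*} [Fintype ι] (x : ι → ℝ) :
    0 ≤ luxemburgNorm M x :=
  Real.sInf_nonneg fun _ ht => ht.1.le

theorem one_lt_sum_of_lt_luxemburgNorm {M : ℝ → ℝ} {ι : Type*} [Fintype ι] {x : ι → ℝ} {t : ℝ}
    (ht : 0 < t) (hlt : t < luxemburgNorm M x) : 1 < ∑ i, M (|x i| / t) := by
  by_contra! hc
  exact hlt.not_ge (csInf_le ⟨0, fun _ hs => hs.1.le⟩ ⟨ht, hc⟩)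

namespace IsAdmissibleOrlicz

variable {p : ℝ≥0∞} {M : ℝ → ℝ} (h : IsAdmissibleOrlicz p M)
include h

theorem momentFun_nonneg' {t : ℝ} (ht : 0 ≤ t) : 0 ≤ momentFun M t := by
  rcases ht.eq_or_lt with rfl | ht
  · rw [h.momentFun_zero]
  · exact h.momentFun_nonneg ht

theorem momentFun_mono {s t : ℝ} (hs : 0 ≤ s) (hst : s ≤ t) : momentFun M s ≤ momentFun M t := by
  rcases hs.eq_or_lt with rfl | hs
  · rw [h.momentFun_zero]
    exact h.momentFun_nonneg' hst
  rcases hst.eq_or_lt with rfl | hst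
  · rfl
  have ht := hs.trans hst
  have h1 := h.orlicz.convexOn.slope_le_of_hasDerivAt (mem_Ici.2 hs.le) (mem_Ici.2 ht.le) hst
    (h.hasDerivAt ht)
  have h2 := h.orlicz.convexOn.le_slope_of_hasDerivAt (mem_Ici.2 hs.le) (mem_Ici.2 ht.le) hst
    (h.hasDerivAt hs)
  rw [slope_def_field] at h1 h2
  have h3 := h2.trans h1
  rw [div_le_iff₀ (sub_pos.2 hst)] at h1
  simp only [momentFun]
  -- By the slope bound at t, the difference of the two sides is at least s (M'(t) - M'(s)), which
  -- is nonnegative.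
  nlinarith

theorem tendsto_mul_div_atTop (b : ℝ) (hb : 0 < b) :
    Tendsto (fun t => t * M (b / t)) atTop (𝓝 0) := by
  have h1 := hasDerivWithinAt_iff_tendsto_slope.1 h.hasDerivWithinAt_zero
  have h2 : Tendsto (fun t : ℝ => b / t) atTop (𝓝[Ici 0 \ {0}] 0) := by
    refine tendsto_nhdsWithin_iff.2 ⟨tendsto_const_nhds.div_atTop tendsto_id, ?_⟩
    filter_upwards [eventually_gt_atTop 0] with t ht
    have : 0 < b / t := by positivity
    exact ⟨this.le, this.ne'⟩
  have h3 := (h1.comp h2).const_mul b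
  rw [mul_zero] at h3
  refine h3.congr' ?_
  filter_upwards [eventually_gt_atTop 0] with t ht
  simp only [Function.comp, slope_def_field, h.orlicz.map_zero, sub_zero]
  field_simp

/-- The integrand has primitive -t M(b/t), which tends to 0 at infinity because M'(0) = 0. This is
how M is recovered from the truncated means. -/
theorem lintegral_momentFun_div {b : ℝ} (hb : 0 ≤ b) :
    ∫⁻ t in Ioi 1, ENNReal.ofReal (momentFun M (b / t)) = ENNReal.ofReal (M b) := by
  rcases hb.eq_or_lt with rfl | hb
  · simp [h.momentFun_zero, h.orlicz.map_zero]
  have hd : ∀ t, 0 < t → HasDerivAt (fun t => -(t * M (b / t))) (momentFun M (b / t)) t :=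
    fun t ht => by
      have hi : HasDerivAt (fun t : ℝ => b / t) (b * -(t ^ 2)⁻¹) t := by
        simpa [div_eq_mul_inv] using (hasDerivAt_inv ht.ne').const_mul b
      have := ((hasDerivAt_id t).mul ((h.hasDerivAt (div_pos hb ht)).comp t hi)).neg
      refine this.congr_deriv ?_
      simp only [momentFun, id, Function.comp]
      field_simp
      ring
  have hc := (hd 1 one_pos).continuousAt.continuousWithinAt (s := Ici 1)
  have hd' : ∀ t ∈ Ioi (1 : ℝ), HasDerivAt (fun t => -(t * M (b / t))) (momentFun M (b / t)) t :=
    fun t ht => hd t (one_pos.trans ht)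
  have h0 : ∀ t ∈ Ioi (1 : ℝ), 0 ≤ momentFun M (b / t) := fun t ht =>
    h.momentFun_nonneg' (div_nonneg hb.le (one_pos.trans ht).le)
  have hl : Tendsto (fun t => -(t * M (b / t))) atTop (𝓝 0) := by
    rw [← neg_zero]
    exact (h.tendsto_mul_div_atTop b hb).neg
  rw [← ofReal_integral_eq_lintegral_ofReal (integrableOn_Ioi_deriv_of_nonneg hc hd' h0 hl)
    (by filter_upwards [ae_restrict_mem measurableSet_Ioi] with t ht using h0 t ht),
    integral_Ioi_of_hasDerivAt_of_nonneg hc hd' h0 hl]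
  simp

variable {q : ℝ} {n : ℕ}

/-- Let m(t) be the sum of the truncated means at scale t, which decreases in t. If m(1) ≥ 1, the
scales t ≤ 1 alone contribute 1 - 1/e. Otherwise m(t) ≤ 1 for t > 1, where 1 - exp(-m) ≥ (1 - 1/e)
m, and ∫_1^∞ m = ∑ M(|b_i|) ≥ 1. -/
theorem ofReal_le_lintegral_of_one_le_sum (hq : 1 < q) (hqp : ENNReal.ofReal q ≤ p)
    (b : Fin n → ℝ) (hb : 1 ≤ ∑ i, M |b i|) :
    ENNReal.ofReal (1 - Real.exp (-1)) ≤ ENNReal.ofReal (q / (q - 1)) *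
      ∫⁻ x, ENNReal.ofReal (ellNorm p fun i => b i * x i)
        ∂(Measure.pi fun _ : Fin n => lawOfDensity (orliczDensity p M)) := by
  have hp : 1 ≤ p := le_trans (by simpa using hq.le) hqp
  have := h.isProbabilityMeasure
  refine le_trans ?_ (lintegral_one_sub_exp_le hq hqp b)
  simp only [h.truncMean_eq hp, abs_div]
  have hmono : ∀ s t : ℝ, 0 < s → s ≤ t →
      ∑ i, momentFun M (|b i| / |t|) ≤ ∑ i, momentFun M (|b i| / |s|) := fun s t hs hst => by
    refine Finset.sum_le_sum fun i _ => h.momentFun_mono (by positivity) ?_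
    rw [abs_of_pos hs, abs_of_pos (hs.trans_le hst)]
    gcongr
  have hnn : ∀ t : ℝ, 0 ≤ ∑ i, momentFun M (|b i| / |t|) := fun t =>
    Finset.sum_nonneg fun i _ => h.momentFun_nonneg' (by positivity)
  have hexp := exp_neg_one_lt_one
  rcases le_total 1 (∑ i, momentFun M (|b i| / |1|)) with h1 | h1
  · calc ENNReal.ofReal (1 - Real.exp (-1))
        = ∫⁻ _ in Ioc (0 : ℝ) 1, ENNReal.ofReal (1 - Real.exp (-1)) := by simp
      _ ≤ ∫⁻ t in Ioc (0 : ℝ) 1,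
          ENNReal.ofReal (1 - Real.exp (-∑ i, momentFun M (|b i| / |t|))) := by
          refine setLIntegral_mono' measurableSet_Ioc fun t ht => ?_
          gcongr
          exact h1.trans (hmono t 1 ht.1 ht.2)
      _ ≤ _ := lintegral_mono_set fun t ht => ht.1
  · have hmeas : ∀ i ∈ Finset.univ, AEMeasurable (fun t : ℝ =>
        ENNReal.ofReal (momentFun M (|b i| / t))) (volume.restrict (Ioi 1)) := fun i _ => by
      refine AEMeasurable.ennreal_ofReal (ContinuousOn.aemeasurable ?_ measurableSet_Ioi)
      rcases (abs_nonneg (b i)).eq_or_lt with hi | hi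
      · simp only [← hi, zero_div]
        exact continuousOn_const
      · refine h.continuousOn_momentFun.comp (continuousOn_const.div continuousOn_id
          fun t ht => (one_pos.trans ht).ne') fun t ht => ?_
        have ht : 0 < t := one_pos.trans ht
        exact (show 0 < |b i| / t by positivity)
    calc ENNReal.ofReal (1 - Real.exp (-1))
        ≤ ENNReal.ofReal (1 - Real.exp (-1)) * ∑ i, ENNReal.ofReal (M |b i|) := by
          rw [← ENNReal.ofReal_sum_of_nonneg fun i _ => h.nonneg (abs_nonneg _)]
          exact le_mul_of_one_le_right' (by simpa using hb)
      _ = ∫⁻ t in Ioi (1 : ℝ), ENNReal.ofReal (1 - Real.exp (-1)) *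
          ∑ i, ENNReal.ofReal (momentFun M (|b i| / t)) := by
          rw [lintegral_const_mul' _ _ ENNReal.ofReal_ne_top, lintegral_finsetSum' _ hmeas]
          simp only [h.lintegral_momentFun_div (abs_nonneg _)]
      _ ≤ ∫⁻ t in Ioi (1 : ℝ),
          ENNReal.ofReal (1 - Real.exp (-∑ i, momentFun M (|b i| / |t|))) := by
          refine setLIntegral_mono' measurableSet_Ioi fun t ht => ?_
          have ht : 1 < t := ht
          have ht0 : 0 < t := one_pos.trans ht
          have h2 := mul_one_sub_exp_neg_one_le (hnn t) ((hmono 1 t one_pos ht.le).trans h1)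
          rw [abs_of_pos ht0] at h2 ⊢
          rw [← ENNReal.ofReal_sum_of_nonneg fun i _ => h.momentFun_nonneg' (by positivity),
            ← ENNReal.ofReal_mul (by linarith)]
          exact ENNReal.ofReal_le_ofReal h2
      _ ≤ _ := lintegral_mono_set (Ioi_subset_Ioi zero_le_one)

theorem ofReal_luxemburgNorm_le_lintegral (hq : 1 < q) (hqp : ENNReal.ofReal q ≤ p)
    (a : Fin n → ℝ) :
    ENNReal.ofReal ((q - 1) / q * (1 - Real.exp (-1)) * luxemburgNorm M a) ≤
      ∫⁻ x, ENNReal.ofReal (ellNorm p fun i => a i * x i)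
        ∂(Measure.pi fun _ : Fin n => lawOfDensity (orliczDensity p M)) := by
  have hp : 1 ≤ p := le_trans (by simpa using hq.le) hqp
  set I := ∫⁻ x, ENNReal.ofReal (ellNorm p fun i => a i * x i)
        ∂(Measure.pi fun _ : Fin n => lawOfDensity (orliczDensity p M)) with hI
  have hexp := sub_pos.2 exp_neg_one_lt_one
  have hq1 : 0 < q - 1 := by linarith
  have hq0 : 0 < q := by linarith
  rcases eq_or_ne I ∞ with hI' | hI'
  · rw [hI']
    exact le_top
  set c := (q - 1) / q * (1 - Real.exp (-1)) with hc
  have hc0 : 0 < c := by positivity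
  rw [ENNReal.ofReal_le_iff_le_toReal hI', mul_comm, ← le_div_iff₀ hc0]
  -- For 0 < t < ‖a‖_M the vector a/t satisfies ∑ M(|a_i|/t) > 1, so the previous lemma applies to
  -- it; then t increases to ‖a‖_M.
  refine le_of_forall_lt_imp_le_of_dense fun t ht => ?_
  rcases le_or_gt t 0 with ht0 | ht0
  · exact ht0.trans (by positivity)
  have h1 := h.ofReal_le_lintegral_of_one_le_sum hq hqp (fun i => a i / t) (by
    simpa only [abs_div, abs_of_pos ht0] using (one_lt_sum_of_lt_luxemburgNorm ht0 ht).le)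
  have hdiv : ∀ x : Fin n → ℝ, ENNReal.ofReal (ellNorm p fun i => a i / t * x i)
      = ENNReal.ofReal t⁻¹ * ENNReal.ofReal (ellNorm p fun i => a i * x i) := fun x => by
    rw [ellNorm_div_mul hp ht0.le, div_eq_inv_mul, ENNReal.ofReal_mul (inv_nonneg.2 ht0.le)]
  simp only [hdiv] at h1
  rw [lintegral_const_mul' _ _ ENNReal.ofReal_ne_top, ← hI, ← ENNReal.ofReal_toReal hI',
    ← ENNReal.ofReal_mul (by positivity), ← ENNReal.ofReal_mul (by positivity),
    ENNReal.ofReal_le_ofReal_iff (by positivity)] at h1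
  rw [le_div_iff₀ hc0, hc]
  have h2 := mul_le_mul_of_nonneg_left h1 (show 0 ≤ t * ((q - 1) / q) by positivity)
  calc _ = t * ((q - 1) / q) * (1 - Real.exp (-1)) := by ring
    _ ≤ _ := h2
    _ = I.toReal := by field_simp

/-- The truncated mean at b_i/t is at most M(2|b_i|/t). The growth condition at s = 2|b_i|,
admissible since M(s) ≤ 1, bounds the i-th layer-cake term by q C M(2|b_i|). -/
theorem lintegral_ellNorm_rpow_le_of_sum_le_one (hq : 1 < q) (hp : 1 ≤ p) {C : ℝ} (hC : 0 ≤ C)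
    (hgrowth : ∀ s : ℝ, 0 < s → M s ≤ 1 →
      ∫⁻ t in Ioo 0 s, ENNReal.ofReal (M t / t ^ q / t) ≤ ENNReal.ofReal (C * (M s / s ^ q)))
    (b : Fin n → ℝ) (hb : ∑ i, M (2 * |b i|) ≤ 1) :
    ∫⁻ x, ENNReal.ofReal ((ellNorm p fun i => b i * x i) ^ q)
        ∂(Measure.pi fun _ : Fin n => lawOfDensity (orliczDensity p M))
      ≤ ENNReal.ofReal (1 + q * C) := by
  have := h.isProbabilityMeasure
  have hq0 : 0 < q := by linarith
  have hM0 : ∀ i, 0 ≤ M (2 * |b i|) := fun i => h.nonneg (by positivity)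
  refine (lintegral_ellNorm_rpow_le hp hq0 b (fun i t => M (2 * |b i| / t)) ?_ ?_).trans ?_
  · intro i
    refine h.continuousOn.comp (continuousOn_const.div continuousOn_id
      fun t ht => (one_pos.trans ht).ne') fun t ht => ?_
    have ht : 0 < t := one_pos.trans ht
    exact (show 0 ≤ 2 * |b i| / t by positivity)
  · intro i t ht
    have ht : 0 < t := one_pos.trans ht
    rw [h.truncMean_eq hp, abs_div, abs_of_pos ht, mul_div_assoc]
    exact h.momentFun_le (by positivity)
  · have hterm : ∀ i, ENNReal.ofReal q * ∫⁻ t in Ioi 1, ENNReal.ofReal (M (2 * |b i| / t)) *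
        ENNReal.ofReal (t ^ (q - 1)) ≤ ENNReal.ofReal (q * C * M (2 * |b i|)) := fun i => by
      rcases (abs_nonneg (b i)).eq_or_lt with hi | hi
      · simp [← hi, h.orlicz.map_zero]
      · have hc : 0 < 2 * |b i| := by positivity
        have hle : M (2 * |b i|) ≤ 1 :=
          (Finset.single_le_sum (fun j _ => hM0 j) (Finset.mem_univ i)).trans hb
        rw [lintegral_comp_div_mul_rpow M q hc]
        calc _ ≤ ENNReal.ofReal q * (ENNReal.ofReal ((2 * |b i|) ^ q) *
              ENNReal.ofReal (C * (M (2 * |b i|) / (2 * |b i|) ^ q))) := by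
              gcongr
              exact hgrowth _ hc hle
          _ = _ := by
              rw [← ENNReal.ofReal_mul (by positivity), ← ENNReal.ofReal_mul hq0.le]
              congr 1
              have := Real.rpow_pos_of_pos hc q
              field_simp
    calc _ ≤ 1 + ∑ i, ENNReal.ofReal (q * C * M (2 * |b i|)) := by
          gcongr with i
          exact hterm i
      _ = ENNReal.ofReal (1 + q * C * ∑ i, M (2 * |b i|)) := by
          rw [← ENNReal.ofReal_sum_of_nonneg fun i _ => mul_nonneg (by positivity) (hM0 i),
            ← Finset.mul_sum, ENNReal.ofReal_add zero_le_one
              (mul_nonneg (by positivity) (Finset.sum_nonneg fun i _ => hM0 i)),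
            ENNReal.ofReal_one]
      _ ≤ _ := by
          refine ENNReal.ofReal_le_ofReal ?_
          have : q * C * ∑ i, M (2 * |b i|) ≤ q * C * 1 := by gcongr
          linarith

/-- Guarantees that the Luxemburg norm is the infimum of a nonempty set and not the default value 0.
-/
theorem exists_sum_le_one (a : Fin n → ℝ) : ∃ t : ℝ, 0 < t ∧ ∑ i, M (|a i| / t) ≤ 1 := by
  have hlim : Tendsto (fun t : ℝ => ∑ i, M (|a i| / t)) atTop (𝓝 (∑ _i : Fin n, 0)) := by
    refine tendsto_finsetSum _ fun i _ => ?_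
    have h1 := h.hasDerivWithinAt_zero.continuousWithinAt.tendsto
    rw [h.orlicz.map_zero] at h1
    refine h1.comp (tendsto_nhdsWithin_iff.2 ⟨tendsto_const_nhds.div_atTop tendsto_id, ?_⟩)
    filter_upwards [eventually_gt_atTop 0] with t ht
    exact mem_Ici.2 (by positivity)
  rw [Finset.sum_const_zero] at hlim
  obtain ⟨t, ht, ht0⟩ := ((hlim.eventually (gt_mem_nhds one_pos)).and
    (eventually_gt_atTop 0)).exists
  exact ⟨t, ht0, ht.le⟩

theorem lintegral_ellNorm_rpow_le_luxemburgNorm (hq : 1 < q) (hp : 1 ≤ p) {C : ℝ} (hC : 0 ≤ C)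
    (hgrowth : ∀ s : ℝ, 0 < s → M s ≤ 1 →
      ∫⁻ t in Ioo 0 s, ENNReal.ofReal (M t / t ^ q / t) ≤ ENNReal.ofReal (C * (M s / s ^ q)))
    (a : Fin n → ℝ) :
    ∫⁻ x, ENNReal.ofReal ((ellNorm p fun i => a i * x i) ^ q)
        ∂(Measure.pi fun _ : Fin n => lawOfDensity (orliczDensity p M))
      ≤ ENNReal.ofReal ((1 + q * C) * (2 * luxemburgNorm M a) ^ q) := by
  have hq0 : 0 < q := by linarith
  have hset : ∀ t : ℝ, 0 < t → ∑ i, M (|a i| / t) ≤ 1 →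
      ∫⁻ x, ENNReal.ofReal ((ellNorm p fun i => a i * x i) ^ q)
        ∂(Measure.pi fun _ : Fin n => lawOfDensity (orliczDensity p M))
      ≤ ENNReal.ofReal ((1 + q * C) * (2 * t) ^ q) := fun t ht hsum => by
    have h2t : 0 < 2 * t := by positivity
    have h1 := h.lintegral_ellNorm_rpow_le_of_sum_le_one hq hp hC hgrowth
      (fun i => a i / (2 * t)) (by
        refine (Finset.sum_congr rfl fun i _ => ?_).trans_le hsum
        rw [abs_div, abs_of_pos h2t]
        congr 1
        field_simp)
    have h3 := Real.rpow_pos_of_pos h2t q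
    calc _ = ∫⁻ x, ENNReal.ofReal ((2 * t) ^ q) *
          ENNReal.ofReal ((ellNorm p fun i => a i / (2 * t) * x i) ^ q)
          ∂(Measure.pi fun _ : Fin n => lawOfDensity (orliczDensity p M)) := by
          refine lintegral_congr fun x => ?_
          rw [← ENNReal.ofReal_mul h3.le, ellNorm_div_mul hp h2t.le,
            Real.div_rpow (ellNorm_nonneg hp _) h2t.le]
          congr 1
          field_simp
      _ ≤ ENNReal.ofReal ((2 * t) ^ q) * ENNReal.ofReal (1 + q * C) := by
          rw [lintegral_const_mul' _ _ ENNReal.ofReal_ne_top]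
          gcongr
      _ = _ := by
          rw [← ENNReal.ofReal_mul h3.le, mul_comm]
  have hlim : Tendsto (fun t => ENNReal.ofReal ((1 + q * C) * (2 * t) ^ q))
      (𝓝[>] (luxemburgNorm M a)) (𝓝 (ENNReal.ofReal ((1 + q * C) * (2 * luxemburgNorm M a) ^ q))) :=
    (ENNReal.continuous_ofReal.comp (continuous_const.mul
      ((continuous_const.mul continuous_id).rpow_const fun _ => Or.inr hq0.le))).continuousAt.tendsto
      |>.mono_left nhdsWithin_le_nhds
  -- Letting t decrease to ‖a‖_M avoids asking whether the infimum is attained and covers ‖a‖_M = 0.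
  refine ge_of_tendsto hlim ?_
  filter_upwards [self_mem_nhdsWithin] with t ht
  obtain ⟨t', ⟨ht'0, hsum⟩, hlt⟩ := exists_lt_of_csInf_lt (h.exists_sum_le_one a) ht
  refine (hset t' ht'0 hsum).trans (ENNReal.ofReal_le_ofReal ?_)
  gcongr

end IsAdmissibleOrlicz

/-! ### The Pareto law generates the ℓ_q norm -/

section Pareto

variable {q : ℝ}

theorem measurable_paretoDensity (q : ℝ) : Measurable (paretoDensity q) :=
  Measurable.ite measurableSet_Ici ((measurable_id.pow_const _).const_mul _) measurable_const

theorem paretoDensity_le (hq : 1 < q) {x : ℝ} (hx : 0 < x) :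
    paretoDensity q x ≤ q * (q - 1) * x ^ (-q - 1) := by
  have h1 : 0 < q - 1 := by linarith
  rw [paretoDensity]
  split_ifs
  · rfl
  · positivity

theorem lintegral_Ioi_pareto (hq : 1 < q) {c : ℝ} (hc : 0 < c) :
    ∫⁻ x in Ioi c, ENNReal.ofReal (q * (q - 1) * x ^ (-q - 1))
      = ENNReal.ofReal ((q - 1) * c ^ (-q)) := by
  have h1 : 0 < q - 1 := by linarith
  have h0 : 0 < q := by linarith
  simp only [ENNReal.ofReal_mul (show 0 ≤ q * (q - 1) by positivity)]
  rw [lintegral_const_mul' _ _ ENNReal.ofReal_ne_top,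
    lintegral_Ioi_ofReal_rpow (by linarith) hc, ← ENNReal.ofReal_mul (by positivity)]
  congr 1
  rw [sub_add_cancel]
  field_simp

theorem lintegral_Ioi_paretoDensity (hq : 1 < q) {c : ℝ} (hc : (q - 1) ^ (1 / q) ≤ c) :
    ∫⁻ x in Ioi c, ENNReal.ofReal (paretoDensity q x)
      = ENNReal.ofReal ((q - 1) * c ^ (-q)) := by
  have h1 : 0 < q - 1 := by linarith
  rw [← lintegral_Ioi_pareto hq ((Real.rpow_pos_of_pos h1 _).trans_le hc)]
  refine setLIntegral_congr_fun measurableSet_Ioi fun x hx => ?_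
  rw [paretoDensity, if_pos (hc.trans (le_of_lt hx))]

theorem isProbabilityMeasure_pareto (hq : 1 < q) :
    IsProbabilityMeasure (lawOfDensity (paretoDensity q)) := by
  have h1 : 0 < q - 1 := by linarith
  refine ⟨?_⟩
  rw [lawOfDensity, withDensity_apply _ MeasurableSet.univ, Measure.restrict_univ]
  have : ∫⁻ x, ENNReal.ofReal (paretoDensity q x)
      = ∫⁻ x in Ici ((q - 1) ^ (1 / q)), ENNReal.ofReal (paretoDensity q x) := by
    rw [setLIntegral_eq_of_support_subset]
    intro x hx
    by_contra hc
    rw [mem_Ici] at hc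
    exact hx (by simp only [paretoDensity, if_neg hc, ENNReal.ofReal_zero])
  rw [this, setLIntegral_congr Ioi_ae_eq_Ici.symm, lintegral_Ioi_paretoDensity hq le_rfl,
    ← Real.rpow_mul h1.le]
  -- The cut-off (q - 1)^(1/q) is the point where the power tail (q - 1) c^(-q) equals 1.
  have : (1 / q) * -q = -1 := by field_simp
  rw [this, Real.rpow_neg_one, mul_inv_cancel₀ h1.ne', ENNReal.ofReal_one]

theorem lintegral_pareto (hq : 1 < q) {g : ℝ → ℝ≥0∞} (hg : Measurable g) :
    ∫⁻ x, g x ∂(lawOfDensity (paretoDensity q))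
      = ∫⁻ x in Ioi 0, ENNReal.ofReal (paretoDensity q x) * g x := by
  rw [lawOfDensity, lintegral_withDensity_eq_lintegral_mul _
    (measurable_paretoDensity q).ennreal_ofReal hg, ← setLIntegral_eq_of_support_subset]
  · rfl
  intro x hx
  by_contra hc
  have h1 : 0 < (q - 1) ^ (1 / q) := Real.rpow_pos_of_pos (by linarith) _
  rw [mem_Ioi, not_lt] at hc
  exact hx (by simp only [Pi.mul_apply, paretoDensity, if_neg (hc.trans_lt h1).not_ge, ENNReal.ofReal_zero,
    zero_mul])

theorem ofReal_truncMean {p : ℝ≥0∞} {ν : Measure ℝ} [IsProbabilityMeasure ν] (b : ℝ) :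
    ENNReal.ofReal (truncMean p ν b) = ∫⁻ x, ENNReal.ofReal (truncPow p |b * x|) ∂ν :=
  ofReal_integral_eq_lintegral_ofReal (integrable_truncPow_abs_mul b)
    (Eventually.of_forall fun _ => truncPow_nonneg (abs_nonneg _))

theorem measurable_ofReal_truncPow (p : ℝ≥0∞) (b : ℝ) :
    Measurable fun x => ENNReal.ofReal (truncPow p |b * x|) :=
  (measurable_truncPow.comp (by fun_prop)).ennreal_ofReal

/-- The event x > 1/|b| alone has probability (q - 1)|b|^q, provided 1/|b| is not below the cut-off
of the density. -/
theorem le_truncMean_pareto {p : ℝ≥0∞} (hq : 1 < q) {b : ℝ}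
    (hb : |b| * (q - 1) ^ (1 / q) ≤ 1) :
    (q - 1) * |b| ^ q ≤ truncMean p (lawOfDensity (paretoDensity q)) b := by
  have := isProbabilityMeasure_pareto hq
  have h1 : 0 < q - 1 := by linarith
  rcases (abs_nonneg b).eq_or_lt with hb0 | hb0
  · rw [← hb0, Real.zero_rpow (by linarith), mul_zero]
    exact truncMean_nonneg b
  have hc : (q - 1) ^ (1 / q) ≤ |b|⁻¹ := by
    rw [le_inv_comm₀ (by positivity) hb0]
    rwa [← le_div_iff₀ (by positivity), one_div] at hb
  rw [← ENNReal.ofReal_le_ofReal_iff (truncMean_nonneg b), ofReal_truncMean,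
    lintegral_pareto hq (measurable_ofReal_truncPow p b)]
  calc _ = ∫⁻ x in Ioi |b|⁻¹, ENNReal.ofReal (paretoDensity q x) := by
        rw [lintegral_Ioi_paretoDensity hq hc, Real.inv_rpow hb0.le, Real.rpow_neg hb0.le, inv_inv]
    _ = ∫⁻ x in Ioi |b|⁻¹, ENNReal.ofReal (paretoDensity q x) *
        ENNReal.ofReal (truncPow p |b * x|) := by
        refine setLIntegral_congr_fun measurableSet_Ioi fun x hx => ?_
        have hx : |b|⁻¹ < x := hx
        have hx0 : 0 < x := (inv_pos.2 hb0).trans hx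
        rw [inv_lt_iff_one_lt_mul₀' hb0] at hx
        rw [abs_mul, abs_of_pos hx0, truncPow_of_one_lt hx, ENNReal.ofReal_one, mul_one]
    _ ≤ _ := lintegral_mono_set (Ioi_subset_Ioi (inv_nonneg.2 hb0.le))

/-- Split at x = 1/|b|. Below it the integrand is at most a multiple of x^(r-q-1), integrable at 0
because r > q: this is where q < p matters. Above it the tail gives (q - 1)|b|^q. -/
theorem truncMean_pareto_le {p : ℝ≥0∞} {r : ℝ} (hq : 1 < q) (hqr : q < r)
    (hrp : ENNReal.ofReal r ≤ p) (b : ℝ) :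
    truncMean p (lawOfDensity (paretoDensity q)) b
      ≤ (q * (q - 1) / (r - q) + (q - 1)) * |b| ^ q := by
  have := isProbabilityMeasure_pareto hq
  have h1 : 0 < q - 1 := by linarith
  have h0 : 0 < q := by linarith
  have hr0 : 0 < r := by linarith
  have hrq : 0 < r - q := by linarith
  rw [← ENNReal.ofReal_le_ofReal_iff (by positivity), ofReal_truncMean,
    lintegral_pareto hq (measurable_ofReal_truncPow p b)]
  have hkey : ∀ x, 0 < x → truncPow p |b * x| ≤ min 1 ((|b| * x) ^ r) := fun x hx => by
    have := truncPow_le_min_rpow hr0 hrp (abs_nonneg (b * x))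
    rwa [show |b * x| = |b| * x by rw [abs_mul, abs_of_pos hx]] at this ⊢
  rcases (abs_nonneg b).eq_or_lt with hb0 | hb0
  · rw [setLIntegral_congr_fun (g := fun _ => 0) measurableSet_Ioi]
    · simp
    · intro x hx
      have := hkey x hx
      rw [← hb0, zero_mul, Real.zero_rpow hr0.ne'] at this
      simp only
      rw [ENNReal.ofReal_of_nonpos (this.trans (min_le_right _ _)), mul_zero]
  have hb' : 0 < |b|⁻¹ := inv_pos.2 hb0
  rw [← Ioc_union_Ioi_eq_Ioi hb'.le, add_mul, ENNReal.ofReal_add (by positivity) (by positivity)]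
  refine (lintegral_union_le _ _ _).trans (add_le_add ?_ ?_)
  · calc _ ≤ ∫⁻ x in Ioc 0 |b|⁻¹, ENNReal.ofReal (q * (q - 1) * |b| ^ r * x ^ (r - q - 1)) := by
          refine setLIntegral_mono' measurableSet_Ioc fun x hx => ?_
          have hx0 : 0 < x := hx.1
          have hx1 : 0 ≤ x ^ (-q - 1) := by positivity
          rw [← ENNReal.ofReal_mul' (truncPow_nonneg (abs_nonneg _))]
          refine ENNReal.ofReal_le_ofReal ?_
          calc _ ≤ (q * (q - 1) * x ^ (-q - 1)) * (|b| * x) ^ r :=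
                mul_le_mul (paretoDensity_le hq hx0) ((hkey x hx0).trans (min_le_right _ _))
                  (truncPow_nonneg (abs_nonneg _)) (by positivity)
            _ = _ := by
                rw [Real.mul_rpow hb0.le hx0.le, show r - q - 1 = r + (-q - 1) by ring,
                  Real.rpow_add hx0]
                ring
      _ = ENNReal.ofReal (∫ x in Ioc 0 |b|⁻¹, q * (q - 1) * |b| ^ r * x ^ (r - q - 1)) := by
          rw [ofReal_integral_eq_lintegral_ofReal]
          · exact ((intervalIntegrable_iff_integrableOn_Ioc_of_le hb'.le).1
              (intervalIntegral.intervalIntegrable_rpow' (by linarith))).const_mul _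
          · filter_upwards [ae_restrict_mem measurableSet_Ioc] with x hx
            have hx0 : 0 < x := hx.1
            show 0 ≤ q * (q - 1) * |b| ^ r * x ^ (r - q - 1)
            positivity
      _ ≤ _ := by
          refine ENNReal.ofReal_le_ofReal (le_of_eq ?_)
          rw [integral_const_mul, ← intervalIntegral.integral_of_le hb'.le,
            integral_rpow (Or.inl (by linarith)), sub_add_cancel, Real.zero_rpow hrq.ne', sub_zero,
            Real.inv_rpow hb0.le, ← Real.rpow_neg hb0.le]
          have : |b| ^ r * |b| ^ (-(r - q)) = |b| ^ q := by
            rw [← Real.rpow_add hb0]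
            congr 1
            ring
          rw [← this]
          ring
  · calc _ ≤ ∫⁻ x in Ioi |b|⁻¹, ENNReal.ofReal (q * (q - 1) * x ^ (-q - 1)) := by
          refine setLIntegral_mono' measurableSet_Ioi fun x hx => ?_
          refine (mul_le_of_le_one_right' ?_).trans
            (ENNReal.ofReal_le_ofReal (paretoDensity_le hq (hb'.trans hx)))
          simpa using truncPow_le_one _
      _ = _ := by
          rw [lintegral_Ioi_pareto hq hb', Real.inv_rpow hb0.le, Real.rpow_neg hb0.le, inv_inv]

variable {n : ℕ}

theorem ellNorm_ofReal_eq_zero (hq : 1 ≤ q) {b : Fin n → ℝ}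
    (hb : ellNorm (ENNReal.ofReal q) b = 0) : b = 0 := by
  have : Fact (1 ≤ ENNReal.ofReal q) := ⟨by simpa using hq⟩
  have h := norm_eq_zero.1 hb
  exact (WithLp.toLp_injective _) (h.trans (WithLp.toLp_zero _).symm)

theorem ellNorm_ofReal_rpow (hq : 1 ≤ q) (b : Fin n → ℝ) :
    ellNorm (ENNReal.ofReal q) b ^ q = ∑ i, |b i| ^ q := by
  have := ellNorm_rpow (p := ENNReal.ofReal q) (by simpa using hq) (by simp) b
  rwa [ENNReal.toReal_ofReal (by linarith)] at this

theorem sum_abs_div_ellNorm_rpow (hq : 1 ≤ q) {b : Fin n → ℝ}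
    (hb : 0 < ellNorm (ENNReal.ofReal q) b) :
    ∑ i, |b i / ellNorm (ENNReal.ofReal q) b| ^ q = 1 := by
  have hp1 : 1 ≤ ENNReal.ofReal q := by simpa using hq
  rw [← ellNorm_ofReal_rpow hq, ellNorm_div hp1 hb.le, div_self hb.ne', Real.one_rpow]

theorem ofReal_ellNorm_le_lintegral_pareto {p : ℝ≥0∞} (hq : 1 < q) (hp : 1 ≤ p)
    (b : Fin n → ℝ) :
    ENNReal.ofReal ((q - 1) ^ (1 / q) * (1 - Real.exp (-1)) * ellNorm (ENNReal.ofReal q) b)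
      ≤ ∫⁻ x, ENNReal.ofReal (ellNorm p fun i => b i * x i)
        ∂(Measure.pi fun _ : Fin n => lawOfDensity (paretoDensity q)) := by
  have := isProbabilityMeasure_pareto hq
  have hexp := sub_pos.2 exp_neg_one_lt_one
  have h1 : 0 < q - 1 := by linarith
  have hp1 : 1 ≤ ENNReal.ofReal q := by simpa using hq.le
  set N := ellNorm (ENNReal.ofReal q) b with hN
  rcases (ellNorm_nonneg hp1 b).eq_or_lt with h0 | h0
  · rw [hN, ← h0]
    simp
  set l := (q - 1) ^ (1 / q) with hl
  have hl0 : 0 < l := Real.rpow_pos_of_pos h1 _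
  have hlq : l ^ q = q - 1 := by
    rw [hl, ← Real.rpow_mul h1.le, one_div_mul_cancel (by linarith), Real.rpow_one]
  -- At this scale the lower bound for the i-th truncated mean is exactly |b_i/N|^q, and these sum
  -- to 1.
  set t := l * N with ht
  have ht0 : 0 < t := mul_pos hl0 h0
  have hsum : 1 ≤ ∑ i, truncMean p (lawOfDensity (paretoDensity q)) (b i / t) := by
    have hdiv := sum_abs_div_ellNorm_rpow hq.le h0
    rw [← hN] at hdiv
    rw [← hdiv]
    refine Finset.sum_le_sum fun i _ => ?_
    have habs : |b i / t| = |b i / N| / l := by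
      rw [ht, mul_comm l, ← div_div, abs_div (b i / N), abs_of_pos hl0]
    have hle1 : |b i / N| ≤ 1 := by
      have h2 : |b i / N| ^ q ≤ 1 := by
        rw [← hdiv]
        exact Finset.single_le_sum (f := fun i => |b i / N| ^ q) (fun j _ => by positivity)
          (Finset.mem_univ i)
      by_contra! hc
      exact h2.not_gt (Real.one_lt_rpow hc (by linarith))
    refine le_trans (le_of_eq ?_) (le_truncMean_pareto hq ?_)
    · rw [habs, Real.div_rpow (abs_nonneg _) hl0.le, hlq]
      field_simp
    · rw [habs, ← hl, div_mul_cancel₀ _ hl0.ne']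
      exact hle1
  have hkey : 1 - Real.exp (-1) ≤ ∫ x, truncPow p (ellNorm p fun i => b i / t * x i)
      ∂(Measure.pi fun _ : Fin n => lawOfDensity (paretoDensity q)) := by
    refine le_trans ?_ (one_sub_exp_le_integral_truncPow_ellNorm hp fun i => b i / t)
    gcongr
  have hm : Measurable fun x : Fin n → ℝ => ellNorm p fun i => b i / t * x i :=
    measurable_ellNorm_mul hp _
  calc _ = ENNReal.ofReal t * ENNReal.ofReal (1 - Real.exp (-1)) := by
        rw [← ENNReal.ofReal_mul ht0.le]
        congr 1
        ring
    _ ≤ ENNReal.ofReal t * ∫⁻ x, ENNReal.ofReal (truncPow p (ellNorm p fun i => b i / t * x i))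
        ∂(Measure.pi fun _ : Fin n => lawOfDensity (paretoDensity q)) := by
        rw [← ofReal_integral_eq_lintegral_ofReal
          (integrable_truncPow_comp hm fun _ => ellNorm_nonneg hp _)
          (Eventually.of_forall fun x => truncPow_nonneg (ellNorm_nonneg hp _))]
        gcongr
    _ ≤ _ := by
        rw [← lintegral_const_mul' _ _ ENNReal.ofReal_ne_top]
        refine lintegral_mono fun x => ?_
        rw [← ENNReal.ofReal_mul ht0.le]
        refine ENNReal.ofReal_le_ofReal ?_
        calc _ ≤ t * (ellNorm p fun i => b i / t * x i) := by
              gcongr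
              exact truncPow_le_self hp (ellNorm_nonneg hp _)
          _ = _ := by
              rw [ellNorm_div_mul hp ht0.le]
              field_simp

/-- After normalizing ‖b‖_q = 1, the layer-cake bound with s = 1 gives 1 + K ∫_1^∞ t^(-q) dt = 1 +
K/(q - 1), which equals q/(r - q) + 2. -/
theorem lintegral_pareto_le_ofReal_ellNorm {p : ℝ≥0∞} {r : ℝ} (hq : 1 < q) (hqr : q < r)
    (hrp : ENNReal.ofReal r ≤ p) (b : Fin n → ℝ) :
    ∫⁻ x, ENNReal.ofReal (ellNorm p fun i => b i * x i)
        ∂(Measure.pi fun _ : Fin n => lawOfDensity (paretoDensity q))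
      ≤ ENNReal.ofReal ((q / (r - q) + 2) * ellNorm (ENNReal.ofReal q) b) := by
  have := isProbabilityMeasure_pareto hq
  have h1 : 0 < q - 1 := by linarith
  have hrq : 0 < r - q := by linarith
  have hq0 : 0 < q := by linarith
  have hp1 : 1 ≤ ENNReal.ofReal q := by simpa using hq.le
  have hp : 1 ≤ p := le_trans (by simpa using (hq.trans hqr).le) hrp
  set N := ellNorm (ENNReal.ofReal q) b with hN
  rcases (ellNorm_nonneg hp1 b).eq_or_lt with h0 | h0
  · have hb := ellNorm_ofReal_eq_zero hq.le h0.symm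
    have hz : ellNorm p (fun _ : Fin n => (0 : ℝ)) = 0 := by
      have := ellNorm_const_mul (ι := Fin n) hp le_rfl fun _ => (0 : ℝ)
      simpa using this
    simp [hb, hz]
  set K := q * (q - 1) / (r - q) + (q - 1) with hK
  have hK0 : 0 < K := by positivity
  have hmain := lintegral_ellNorm_rpow_le (ν := lawOfDensity (paretoDensity q)) hp one_pos
    (fun i => b i / N) (fun i t => K * |b i / N| ^ q * t ^ (-q))
    (fun i => continuousOn_const.mul fun t ht => (Real.continuousAt_rpow_const _ _
      (Or.inl (one_pos.trans ht).ne')).continuousWithinAt)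
    (fun i t ht => by
      have ht0 : 0 < t := one_pos.trans ht
      refine (truncMean_pareto_le hq hqr hrp _).trans (le_of_eq ?_)
      rw [abs_div (b i / N), abs_of_pos ht0, Real.div_rpow (abs_nonneg _) ht0.le,
        Real.rpow_neg ht0.le]
      ring)
  have hterm : ∀ i, ∫⁻ t in Ioi 1, ENNReal.ofReal (K * |b i / N| ^ q * t ^ (-q))
      = ENNReal.ofReal (K / (q - 1) * |b i / N| ^ q) := fun i => by
    have hnn : 0 ≤ K * |b i / N| ^ q := by positivity
    simp only [ENNReal.ofReal_mul hnn]
    rw [lintegral_const_mul' _ _ ENNReal.ofReal_ne_top,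
      lintegral_Ioi_ofReal_rpow (by linarith) one_pos, ← ENNReal.ofReal_mul hnn]
    congr 1
    have : -q + 1 = -(q - 1) := by ring
    rw [Real.one_rpow, this, neg_div_neg_eq]
    ring
  simp only [Real.rpow_one, sub_self, Real.rpow_zero, ENNReal.ofReal_one, mul_one, one_mul,
    hterm] at hmain
  rw [← ENNReal.ofReal_sum_of_nonneg fun i _ => by positivity, ← Finset.mul_sum,
    sum_abs_div_ellNorm_rpow hq.le h0, mul_one, ← ENNReal.ofReal_one,
    ← ENNReal.ofReal_add zero_le_one (by positivity)] at hmain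
  calc _ = ENNReal.ofReal N * ∫⁻ x, ENNReal.ofReal (ellNorm p fun i => b i / N * x i)
        ∂(Measure.pi fun _ : Fin n => lawOfDensity (paretoDensity q)) := by
        rw [← lintegral_const_mul' _ _ ENNReal.ofReal_ne_top]
        refine lintegral_congr fun x => ?_
        rw [← ENNReal.ofReal_mul h0.le, ellNorm_div_mul hp h0.le]
        congr 1
        field_simp
    _ ≤ ENNReal.ofReal N * ENNReal.ofReal (1 + K / (q - 1)) := by gcongr
    _ = _ := by
        rw [← ENNReal.ofReal_mul h0.le]
        congr 1
        rw [hK]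
        field_simp
        ring

end Pareto

/-! ### Separating the two families, and ℓ_q norms of random vectors -/

/-- The joint law of the combined family is a product measure; splitting its coordinates and
applying Tonelli puts the ξ-average inside, with X frozen. -/
theorem lintegral_comp_of_iIndepFun {ι κ Ω : Type*} [Fintype ι] [Fintype κ] [MeasurableSpace Ω]
    {μ : Measure Ω} [IsProbabilityMeasure μ] {ν₁ ν₂ : Measure ℝ} [IsProbabilityMeasure ν₁]
    [IsProbabilityMeasure ν₂] {ξ : ι → Ω → ℝ} {X : κ → Ω → ℝ}
    (hξ : ∀ i, HasLaw (ξ i) ν₁ μ) (hX : ∀ j, HasLaw (X j) ν₂ μ)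
    (hind : iIndepFun (Sum.elim ξ X) μ) {G : (ι → ℝ) × (κ → ℝ) → ℝ≥0∞} (hG : Measurable G) :
    ∫⁻ ω, G (fun i => ξ i ω, fun j => X j ω) ∂μ
      = ∫⁻ y, ∫⁻ x, G (x, y) ∂(Measure.pi fun _ : ι => ν₁) ∂(Measure.pi fun _ : κ => ν₂) := by
  have hm : ∀ k, AEMeasurable (Sum.elim ξ X k) μ := by
    rintro (i | j)
    exacts [(hξ i).aemeasurable, (hX j).aemeasurable]
  let ν : ι ⊕ κ → Measure ℝ := fun k => μ.map (Sum.elim ξ X k)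
  have : ∀ k, IsProbabilityMeasure (ν k) := fun k => Measure.isProbabilityMeasure_map (hm k)
  have hmap := (iIndepFun_iff_map_fun_eq_pi_map hm).1 hind
  have hmp := measurePreserving_sumPiEquivProdPi (X := fun _ : ι ⊕ κ => ℝ) ν
  have h1 : (fun i => ν (Sum.inl i)) = fun _ : ι => ν₁ := funext fun i => (hξ i).map_eq
  have h2 : (fun i => ν (Sum.inr i)) = fun _ : κ => ν₂ := funext fun j => (hX j).map_eq
  rw [h1, h2] at hmp
  rw [← lintegral_prod_symm _ hG.aemeasurable, ← hmp.lintegral_comp hG]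
  change _ = ∫⁻ z, _ ∂(Measure.pi fun k => μ.map (Sum.elim ξ X k))
  rw [← hmap]
  exact (lintegral_map' (hG.comp (MeasurableEquiv.sumPiEquivProdPi fun _ : ι ⊕ κ => ℝ).measurable).aemeasurable
    (aemeasurable_pi_lambda (fun ω k => Sum.elim ξ X k ω) hm)).symm

section Moments

variable {α : Type*} [MeasurableSpace α] {μ : Measure α} {ι : Type*} [Fintype ι] {q : ℝ}

theorem lintegral_ofReal_le_rpow [IsProbabilityMeasure μ] (hq : 1 ≤ q) {g : α → ℝ}
    (hg : Measurable g) (hg0 : ∀ x, 0 ≤ g x) :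
    ∫⁻ x, ENNReal.ofReal (g x) ∂μ ≤ (∫⁻ x, ENNReal.ofReal (g x ^ q) ∂μ) ^ (1 / q) := by
  have := eLpNorm'_le_eLpNorm'_of_exponent_le one_pos hq μ hg.aestronglyMeasurable
  simpa only [eLpNorm', Real.enorm_of_nonneg (hg0 _), ENNReal.rpow_one, div_one,
    ENNReal.ofReal_rpow_of_nonneg (hg0 _) (zero_le_one.trans hq)] using this

/-- Jensen passes to the q-th moment of the ℓ_q norm, which is the sum of the q-th moments of the
coordinates. -/
theorem lintegral_ellNorm_le_of_lintegral_rpow_le [IsProbabilityMeasure μ] (hq : 1 ≤ q)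
    {Y : ι → α → ℝ} (hY : ∀ i, Measurable (Y i)) (hY0 : ∀ i x, 0 ≤ Y i x) {A : ℝ} (hA : 0 ≤ A)
    {l : ι → ℝ} (hl : ∀ i, 0 ≤ l i)
    (hle : ∀ i, ∫⁻ x, ENNReal.ofReal (Y i x ^ q) ∂μ ≤ ENNReal.ofReal (A * l i ^ q)) :
    ∫⁻ x, ENNReal.ofReal (ellNorm (ENNReal.ofReal q) fun i => Y i x) ∂μ
      ≤ ENNReal.ofReal (A ^ (1 / q) * ellNorm (ENNReal.ofReal q) l) := by
  have hp : 1 ≤ ENNReal.ofReal q := by simpa using hq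
  have hq0 : 0 < q := by linarith
  refine (lintegral_ofReal_le_rpow hq ((continuous_ellNorm hp).measurable.comp
    (measurable_pi_lambda _ hY)) fun x => ellNorm_nonneg hp _).trans ?_
  have hpow : ∀ x, (ellNorm (ENNReal.ofReal q) fun i => Y i x) ^ q = ∑ i, Y i x ^ q := fun x => by
    rw [ellNorm_ofReal hq, ← Real.rpow_mul (by positivity), one_div_mul_cancel hq0.ne',
      Real.rpow_one]
    simp only [abs_of_nonneg (hY0 _ _)]
  have hS : 0 ≤ ∑ i, l i ^ q := Finset.sum_nonneg fun i _ => Real.rpow_nonneg (hl i) _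
  calc (∫⁻ x, ENNReal.ofReal ((ellNorm (ENNReal.ofReal q) fun i => Y i x) ^ q) ∂μ) ^ (1 / q)
      = (∑ i, ∫⁻ x, ENNReal.ofReal (Y i x ^ q) ∂μ) ^ (1 / q) := by
        rw [← lintegral_finsetSum _ fun i _ => ((hY i).pow_const q).ennreal_ofReal]
        simp only [hpow, ENNReal.ofReal_sum_of_nonneg fun i _ => Real.rpow_nonneg (hY0 i _) q]
    _ ≤ (ENNReal.ofReal (A * ∑ i, l i ^ q)) ^ (1 / q) := by
        gcongr
        rw [Finset.mul_sum, ENNReal.ofReal_sum_of_nonneg fun i _ =>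
          mul_nonneg hA (Real.rpow_nonneg (hl i) _)]
        exact Finset.sum_le_sum fun i _ => hle i
    _ = _ := by
        rw [ENNReal.ofReal_rpow_of_nonneg (mul_nonneg hA hS) (by positivity),
          Real.mul_rpow hA hS, ellNorm_ofReal hq]
        simp only [abs_of_nonneg (hl _)]

theorem integrable_of_lintegral_ofReal_ne_top {g : α → ℝ} (hg : AEStronglyMeasurable g μ)
    (hg0 : ∀ x, 0 ≤ g x) (hfin : ∫⁻ x, ENNReal.ofReal (g x) ∂μ ≠ ∞) : Integrable g μ :=
  ⟨hg, (hasFiniteIntegral_iff_ofReal (Eventually.of_forall hg0)).2 hfin.lt_top⟩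

/-- The norm of a Bochner integral is at most the integral of the norm, applied in ℓ_q; if the right
side is infinite there is nothing to prove. -/
theorem ofReal_ellNorm_le_lintegral_of_le (hq : 1 ≤ q) {Y : ι → α → ℝ}
    (hY : ∀ i, Measurable (Y i)) (hY0 : ∀ i x, 0 ≤ Y i x) {l : ι → ℝ} (hl : ∀ i, 0 ≤ l i)
    (hle : ∀ i, ENNReal.ofReal (l i) ≤ ∫⁻ x, ENNReal.ofReal (Y i x) ∂μ) :
    ENNReal.ofReal (ellNorm (ENNReal.ofReal q) l)
      ≤ ∫⁻ x, ENNReal.ofReal (ellNorm (ENNReal.ofReal q) fun i => Y i x) ∂μ := by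
  have hp : 1 ≤ ENNReal.ofReal q := by simpa using hq
  have : Fact (1 ≤ ENNReal.ofReal q) := ⟨hp⟩
  have hm : Measurable fun x => ellNorm (ENNReal.ofReal q) fun i => Y i x :=
    (continuous_ellNorm hp).measurable.comp (measurable_pi_lambda _ hY)
  rcases eq_or_ne (∫⁻ x, ENNReal.ofReal (ellNorm (ENNReal.ofReal q) fun i => Y i x) ∂μ) ∞
    with htop | htop
  · rw [htop]
    exact le_top
  have hint := integrable_of_lintegral_ofReal_ne_top hm.aestronglyMeasurable
    (fun x => ellNorm_nonneg hp _) htop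
  have hYi : ∀ i, Integrable (Y i) μ := fun i => by
    refine hint.mono' (hY i).aestronglyMeasurable (Eventually.of_forall fun x => ?_)
    exact PiLp.norm_apply_le (WithLp.toLp (ENNReal.ofReal q) fun i => Y i x) i
  let F : α → PiLp (ENNReal.ofReal q) fun _ : ι => ℝ := fun x => WithLp.toLp _ fun i => Y i x
  have hF : ∫ x, F x ∂μ = WithLp.toLp _ fun i => ∫ x, Y i x ∂μ := by
    ext i
    exact eval_integral_piLp hYi i
  have hnorm := norm_integral_le_integral_norm (μ := μ) F
  rw [hF] at hnorm
  rw [← ofReal_integral_eq_lintegral_ofReal hint (Eventually.of_forall fun x => ellNorm_nonneg hp _)]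
  refine ENNReal.ofReal_le_ofReal (le_trans (ellNorm_ofReal_mono hq fun i => ?_) hnorm)
  have h1 := hle i
  rw [← ofReal_integral_eq_lintegral_ofReal (hYi i) (Eventually.of_forall (hY0 i)),
    ENNReal.ofReal_le_ofReal_iff (integral_nonneg (hY0 i))] at h1
  rw [abs_of_nonneg (hl i)]
  exact h1.trans (le_abs_self _)

end Moments

end

/-! ### The two-sided estimate -/

theorem theorem1p1 (p : ℝ≥0∞) (q : ℝ) (hq : 1 < q) (hqp : ENNReal.ofReal q < p) :
    -- `c₁` depends only on `p, q`; `c₂` only on `p, q` and the constant `C`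
    ∃ c₁ : ℝ, 0 < c₁ ∧ ∀ C : ℝ, ∃ c₂ : ℝ, 0 < c₂ ∧
      ∀ M : ℝ → ℝ,
        IsOrliczFunction M →
        IsNormalizedOrlicz M →
        ContDiffOn ℝ 3 M (Ioi 0) →
        -- the right derivative of `M` at `0` is `0`
        HasDerivWithinAt M 0 (Ici 0) 0 →
        -- `M` is affine on some `[T, ∞)`
        (∃ T : ℝ, 0 < T ∧ ∃ α β : ℝ, ∀ t, T ≤ t → M t = α * t + β) →
        -- the limit of `M''(t) / t^(q-2)` at `0⁺` exists in the extended reals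
        (∃ L : EReal, Tendsto (fun t : ℝ => ((iteratedDeriv 2 M t / t ^ (q - 2) : ℝ) : EReal))
          (𝓝[>] 0) (𝓝 L)) →
        -- the growth condition, for `0 < s ≤ M⁻¹(1)`
        (∀ s : ℝ, 0 < s → M s ≤ 1 →
          ∫⁻ t in Ioo 0 s, ENNReal.ofReal (M t / t ^ q / t)
            ≤ ENNReal.ofReal (C * (M s / s ^ q))) →
        (∀ s : ℝ, 0 < s → 0 ≤ orliczDensity p M s) →
        IsProbabilityDensity (orliczDensity p M) ∧
        ∀ (n : ℕ) (a : Fin n → Fin n → ℝ)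
          (Ω : Type*) [MeasurableSpace Ω] (μ : Measure Ω) [IsProbabilityMeasure μ]
          (ξ X : Fin n → Ω → ℝ),
          (∀ i, HasLaw (ξ i) (lawOfDensity (paretoDensity q)) μ) →
          (∀ j, HasLaw (X j) (lawOfDensity (orliczDensity p M)) μ) →
          -- `ξ₁, …, ξₙ, X₁, …, Xₙ` are independent
          iIndepFun (Sum.elim ξ X) μ →
          Integrable (fun ω => ellNorm p fun ij : Fin n × Fin n =>
            a ij.1 ij.2 * ξ ij.1 ω * X ij.2 ω) μ ∧
          c₁ * ellNorm (ENNReal.ofReal q) (fun i => luxemburgNorm M (a i))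
            ≤ ∫ ω, ellNorm p (fun ij : Fin n × Fin n => a ij.1 ij.2 * ξ ij.1 ω * X ij.2 ω) ∂μ ∧
          ∫ ω, ellNorm p (fun ij : Fin n × Fin n => a ij.1 ij.2 * ξ ij.1 ω * X ij.2 ω) ∂μ
            ≤ c₂ * ellNorm (ENNReal.ofReal q) (fun i => luxemburgNorm M (a i)) := by
  have hp1 : 1 ≤ ENNReal.ofReal q := by simpa using hq.le
  have hp : 1 ≤ p := hp1.trans hqp.le
  have hq0 : 0 < q := by linarith
  have hq1 : 0 < q - 1 := by linarith
  have hexp := sub_pos.2 exp_neg_one_lt_one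
  -- A finite exponent standing in for p in the Pareto upper bound, chosen from p and q alone so
  -- that the constants depend on nothing else.
  obtain ⟨r, hqr, hrp⟩ : ∃ r, q < r ∧ ENNReal.ofReal r ≤ p := by
    rcases eq_or_ne p ∞ with rfl | hp'
    · exact ⟨q + 1, by linarith, le_top⟩
    · exact ⟨p.toReal, (ENNReal.ofReal_lt_iff_lt_toReal hq0.le hp').1 hqp,
        (ENNReal.ofReal_toReal hp').le⟩
  have hrq : 0 < r - q := by linarith
  set cξ := (q - 1) ^ (1 / q) * (1 - Real.exp (-1)) with hcξ
  set cX := (q - 1) / q * (1 - Real.exp (-1)) with hcX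
  have hcξ0 : 0 < cξ := by positivity
  have hcX0 : 0 < cX := by positivity
  refine ⟨cξ * cX, by positivity, fun C => ?_⟩
  -- C may be negative; enlarging it to D keeps the growth condition valid and makes c₂ positive.
  set D := max C 0 with hD
  have hD0 : 0 ≤ D := le_max_right _ _
  set A := (1 + q * D) * 2 ^ q with hA
  have hA0 : 0 < A := by positivity
  set K := q / (r - q) + 2 with hK
  have hK0 : 0 < K := by positivity
  refine ⟨K * A ^ (1 / q), by positivity,
    fun M hM hnorm hdiff hder haff _ hgrowth hdens => ?_⟩
  have h : IsAdmissibleOrlicz p M := ⟨hM, hnorm, hdiff, hder, haff, hdens⟩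
  have hgrowth' : ∀ s : ℝ, 0 < s → M s ≤ 1 →
      ∫⁻ t in Ioo 0 s, ENNReal.ofReal (M t / t ^ q / t) ≤ ENNReal.ofReal (D * (M s / s ^ q)) :=
    fun s hs hs1 => (hgrowth s hs hs1).trans (ENNReal.ofReal_le_ofReal
      (mul_le_mul_of_nonneg_right (le_max_left _ _)
        (div_nonneg (h.nonneg hs.le) (Real.rpow_nonneg hs.le _))))
  refine ⟨h.isProbabilityDensity, fun n a Ω _ μ _ ξ X hξ hX hind => ?_⟩
  have := isProbabilityMeasure_pareto hq
  have := h.isProbabilityMeasure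
  set P := Measure.pi fun _ : Fin n => lawOfDensity (paretoDensity q)
  set Q := Measure.pi fun _ : Fin n => lawOfDensity (orliczDensity p M) with hQ
  set g : Ω → ℝ := fun ω => ellNorm p fun ij : Fin n × Fin n =>
    a ij.1 ij.2 * ξ ij.1 ω * X ij.2 ω with hg
  have hg0 : ∀ ω, 0 ≤ g ω := fun ω => ellNorm_nonneg hp _
  set Y : Fin n → (Fin n → ℝ) → ℝ := fun i y => ellNorm p fun j => a i j * y j with hYdef
  have hY : ∀ i, Measurable (Y i) := fun i => measurable_ellNorm_mul hp (a i)
  have hY0 : ∀ i y, 0 ≤ Y i y := fun i y => ellNorm_nonneg hp _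
  set l : Fin n → ℝ := fun i => luxemburgNorm M (a i) with hl
  have hl0 : ∀ i, 0 ≤ l i := fun i => luxemburgNorm_nonneg M _
  set N := ellNorm (ENNReal.ofReal q) l with hN
  have hN0 : 0 ≤ N := ellNorm_nonneg hp1 _
  have hgm : AEStronglyMeasurable g μ := by
    refine ((continuous_ellNorm hp).measurable.comp_aemeasurable
      (aemeasurable_pi_lambda _ fun ij => ?_)).aestronglyMeasurable
    exact ((hξ ij.1).aemeasurable.const_mul _).mul (hX ij.2).aemeasurable
  have hI : ∫⁻ ω, ENNReal.ofReal (g ω) ∂μ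
      = ∫⁻ y, ∫⁻ x, ENNReal.ofReal (ellNorm p fun i => Y i y * x i) ∂P ∂Q := by
    have hG : Measurable fun z : (Fin n → ℝ) × (Fin n → ℝ) =>
        ENNReal.ofReal (ellNorm p fun i => Y i z.2 * z.1 i) := by
      refine ((continuous_ellNorm hp).measurable.comp
        (measurable_pi_lambda _ fun i => ?_)).ennreal_ofReal
      exact ((hY i).comp measurable_snd).mul ((measurable_pi_apply i).comp measurable_fst)
    rw [← lintegral_comp_of_iIndepFun hξ hX hind hG]
    refine lintegral_congr fun ω => ?_
    have := ellNorm_prod hp (fun i => ξ i ω) fun i j => a i j * X j ω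
    simp only [hg, hYdef]
    congr 1
    rw [show (fun ij : Fin n × Fin n => a ij.1 ij.2 * ξ ij.1 ω * X ij.2 ω)
      = fun ij : Fin n × Fin n => ξ ij.1 ω * (a ij.1 ij.2 * X ij.2 ω) from
        funext fun ij => by ring, this]
    congr 1
    funext i
    ring
  have hupper : ∫⁻ ω, ENNReal.ofReal (g ω) ∂μ ≤ ENNReal.ofReal (K * A ^ (1 / q) * N) := by
    rw [hI]
    calc _ ≤ ∫⁻ y, ENNReal.ofReal K *
          ENNReal.ofReal (ellNorm (ENNReal.ofReal q) fun i => Y i y) ∂Q := by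
          refine lintegral_mono fun y => ?_
          rw [← ENNReal.ofReal_mul hK0.le]
          exact lintegral_pareto_le_ofReal_ellNorm hq hqr hrp _
      _ ≤ ENNReal.ofReal K * ENNReal.ofReal (A ^ (1 / q) * N) := by
          rw [lintegral_const_mul' _ _ ENNReal.ofReal_ne_top]
          gcongr
          refine lintegral_ellNorm_le_of_lintegral_rpow_le hq.le hY hY0 hA0.le hl0 fun i => ?_
          refine (h.lintegral_ellNorm_rpow_le_luxemburgNorm hq hp hD0 hgrowth' (a i)).trans_eq ?_
          rw [Real.mul_rpow zero_le_two (hl0 i), hA, mul_assoc]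
      _ = _ := by
          rw [← ENNReal.ofReal_mul hK0.le, mul_assoc]
  have hlower : ENNReal.ofReal (cξ * cX * N) ≤ ∫⁻ ω, ENNReal.ofReal (g ω) ∂μ := by
    rw [hI]
    calc ENNReal.ofReal (cξ * cX * N)
        = ENNReal.ofReal cξ * ENNReal.ofReal (ellNorm (ENNReal.ofReal q) fun i => cX * l i) := by
          rw [ellNorm_const_mul hp1 hcX0.le, ← ENNReal.ofReal_mul hcξ0.le, mul_assoc]
      _ ≤ ENNReal.ofReal cξ *
          ∫⁻ y, ENNReal.ofReal (ellNorm (ENNReal.ofReal q) fun i => Y i y) ∂Q := by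
          gcongr
          exact ofReal_ellNorm_le_lintegral_of_le hq.le hY hY0
            (fun i => mul_nonneg hcX0.le (hl0 i))
            fun i => h.ofReal_luxemburgNorm_le_lintegral hq hqp.le (a i)
      _ ≤ _ := by
          rw [← lintegral_const_mul' _ _ ENNReal.ofReal_ne_top]
          refine lintegral_mono fun y => ?_
          rw [← ENNReal.ofReal_mul hcξ0.le]
          exact ofReal_ellNorm_le_lintegral_pareto hq hp _
  have htop : ∫⁻ ω, ENNReal.ofReal (g ω) ∂μ ≠ ∞ :=
    (hupper.trans_lt ENNReal.ofReal_lt_top).ne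
  refine ⟨integrable_of_lintegral_ofReal_ne_top hgm hg0 htop, ?_, ?_⟩
  · rw [integral_eq_lintegral_of_nonneg_ae (Eventually.of_forall hg0) hgm]
    exact (ENNReal.ofReal_le_iff_le_toReal htop).1 hlower
  · rw [integral_eq_lintegral_of_nonneg_ae (Eventually.of_forall hg0) hgm]
    exact ENNReal.toReal_le_of_le_ofReal (by positivity) hupper
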